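/- Let $p:Y\to X$ be a ramified Galois cover of smooth projective curves over $\mathbb{C}$, $y\in Y$ a ramification point, $x=p(y)$, and $\Gamma_y$ the isotropy group of $y$. Let $(W,q')$ be a vector bundle of rank $n$ on $Y$ with a compatible action of the Galois group and an invariant, everywhere non-degenerate quadratic form. Everything below is local at $y$: $\mathcal{O}_y$ and $\mathcal{O}_x$ are the rings of germs at $y$ and $x$ (analytic, henselian or formal), so that $\mathcal{O}_x=\mathcal{O}_y^{\Gamma_y}$, and $W$ is identified with its module of germs. Explicitly, the data used are: * discrete valuation rings $\mathcal{O}_x\subset\mathcal{O}_y$ that are $\mathbb{C}$-algebras, $\mathcal{O}_y$ finite over $\mathcal{O}_x$ and with residue field $\mathbb{C}$, and a finite group $\Gamma_y$ acting faithfully on $\mathcal{O}_y$ by $\mathcal{O}_x$-algebra automorphisms, with $\mathcal{O}_y^{\Gamma_y}=\mathcal{O}_x$; the maximal ideals are $m_x$, $m_y$; * a free $\mathcal{O}_y$-module $W$ of finite rank $n$ with a semilinear action of $\Gamma_y$ and a symmetric bilinear form $q':W\times W\to\mathcal{O}_y$ that induces an isomorphism $W\cong W^*$ and satisfies $q'(\gamma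 v,\gamma w)=\gamma\, q'(v,w)$. Let $O_n(\mathcal{O}_y)^{\Gamma_y}$ be the group of $\mathcal{O}_y$-linear automorphisms of $W$ that preserve $q'$ and commute with $\Gamma_y$. Put $V=W^{\Gamma_y}$, a free $\mathcal{O}_x$-module, let $\overline{q_x}:V\times V\to\mathcal{O}_x$ be the restriction of $q'$, let $V_x=V/m_xV$ be the fibre, and let $q_x$ be the form on $V_x$ with values in $\mathcal{O}_x/m_x=\mathbb{C}$ induced by $\overline{q_x}$. For $c\ge 1$ let $F_y^c\subset V_x$ be the image of $V\cap m_y^cW$. Let $F^1_x\supsetneq F^2_x\supsetneq\cdots\supsetneq F^{m}_x$ be the distinct non-zero subspaces among the $F_y^c$, $c\ge1$, and put $F^0_x=V_x$, $F_x^{i}=0$ for $i>m$, and $G_x^i=F_x^i/F_x^{i+1}$ (the case $F^1_x=F^0_x$ is allowed). Then $(V,\overline{q_x},F_x^\bullet)$ is a degenerate orthogonal bundle with flags at $x$, that is: $m_x$ kills the cokernel of $V\to V^*$; $F^1_x=\ker(q_x)$; $\overline{q_x}$ induces a non-degenerate form $q_{1,x}$ on $F^1_x$ with values in $m_x/m_x^2\cong\mathbb{C}$;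 and $F_x^{m+2-i}$ is the orthogonal complement of $F_x^i$ in $(F_x^1,q_{1,x})$ for $1\le i\le m+1$. Consequently $q_{1,x}$ induces pairings $q_{i,x}:G_x^i\times G_x^{m+1-i}\to m_x/m_x^2\cong\mathbb{C}$ for $1\le i\le m$, in particular a quadratic form $q_{(1+m)/2,x}$ on $G_x^{(1+m)/2}$ when $m$ is odd, and $q_x$ induces a quadratic form $q_{0,x}:G_x^0\to\mathbb{C}$. Let $\mathrm{Aut}_x(V,q,F)$ be the group of all $g\in\mathrm{GL}(V)$ ($\mathcal{O}_x$-linear automorphisms) that preserve $\overline{q_x}$ and whose action on $V_x$ preserves each $F_x^i$, and whose induced action on the graded pieces preserves all the pairings $q_{i,x}$, the quadratic form $q_{0,x}$ and, if $m$ is odd, the quadratic form $q_{(1+m)/2,x}$. **Proposition.** The $\mathcal{O}_x$-module $V$ has rank $n$ (so $\mathrm{GL}(V)\cong\mathrm{GL}_n(\mathcal{O}_x)$). The pairings $q_{i,x}$ on $G_x^i\times G_x^{m+1-i}$ for $1\le i\le m$ and the form $q_{0,x}$ on $G_x^0$ are perfect. Restriction $\theta\mapsto\theta|_V$ to the invariants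 is an isomorphism of groups $$O_n(\mathcal{O}_y)^{\Gamma_y}\;\xrightarrow{\ \sim\ }\;\mathrm{Aut}_x(V,q,F).$$ -/

import Mathlib

open IsLocalRing

set_option linter.unusedSectionVars false

namespace OrthogonalGerm

noncomputable section

section Descent

variable {R A A' G G' C : Type*} [CommRing R] [AddCommGroup A] [Module R A]
  [AddCommGroup A'] [Module R A'] [AddCommGroup G] [Module R G] [AddCommGroup G'] [Module R G']
  [AddCommGroup C] [Module R C]

/-- The linear map induced on the target of a surjection. -/
def descend (π : A →ₗ[R] G) (hπ : Function.Surjective π) (f : A →ₗ[R] C)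
    (h : ∀ a, π a = 0 → f a = 0) : G →ₗ[R] C :=
  (Submodule.liftQ (LinearMap.ker π) f (fun a ha => h a ha)) ∘ₗ
    (π.quotKerEquivOfSurjective hπ).symm.toLinearMap

theorem descend_apply (π : A →ₗ[R] G) (hπ : Function.Surjective π) (f : A →ₗ[R] C)
    (h : ∀ a, π a = 0 → f a = 0) (a : A) : descend π hπ f h (π a) = f a := by
  have : (π.quotKerEquivOfSurjective hπ).symm (π a) = Submodule.Quotient.mk a := by
    rw [LinearEquiv.symm_apply_eq]; rfl
  rw [descend, LinearMap.comp_apply, LinearEquiv.coe_coe, this]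
  rfl

/-- The bilinear map induced on the targets of two surjections. -/
def descendBilin (π : A →ₗ[R] G) (hπ : Function.Surjective π) (π' : A' →ₗ[R] G')
    (hπ' : Function.Surjective π') (β : A →ₗ[R] A' →ₗ[R] C)
    (h : ∀ a, π a = 0 → ∀ b, β a b = 0) (h' : ∀ b, π' b = 0 → ∀ a, β a b = 0) :
    G →ₗ[R] G' →ₗ[R] C :=
  descend π hπ
    { toFun := fun a => descend π' hπ' (β a) (fun b hb => h' b hb a)
      map_add' := fun a a' => by
        ext x
        obtain ⟨b, rfl⟩ := hπ' x
        simp [descend_apply]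
      map_smul' := fun r a => by
        ext x
        obtain ⟨b, rfl⟩ := hπ' x
        simp [descend_apply] }
    (fun a ha => by
      ext x
      obtain ⟨b, rfl⟩ := hπ' x
      simp [descend_apply, h a ha b])

theorem descendBilin_apply (π : A →ₗ[R] G) (hπ : Function.Surjective π) (π' : A' →ₗ[R] G')
    (hπ' : Function.Surjective π') (β : A →ₗ[R] A' →ₗ[R] C)
    (h : ∀ a, π a = 0 → ∀ b, β a b = 0) (h' : ∀ b, π' b = 0 → ∀ a, β a b = 0) (a : A) (b : A') :
    descendBilin π hπ π' hπ' β h h' (π a) (π' b) = β a b := by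
  simp [descendBilin, descend_apply]

end Descent

section Fibre

variable (R V : Type*) [CommRing R] [IsLocalRing R] [AddCommGroup V] [Module R V]

/-- The fibre `V_x = V / m_x V` of a module over a local ring `R = O_x`. Its `R`-submodules are
the same thing as its subspaces over the residue field. -/
abbrev Fibre : Type _ := V ⧸ (maximalIdeal R • ⊤ : Submodule R V)

variable {R V}

/-- The class of `v` in the fibre. -/
def toFibre : V →ₗ[R] Fibre R V := Submodule.mkQ _

theorem toFibre_surjective : Function.Surjective (toFibre : V →ₗ[R] Fibre R V) :=
  Submodule.mkQ_surjective _

theorem toFibre_eq_zero {v : V} :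
    toFibre v = (0 : Fibre R V) ↔ v ∈ (maximalIdeal R • ⊤ : Submodule R V) :=
  Submodule.Quotient.mk_eq_zero _

/-- The endomorphism of the fibre induced by an endomorphism of `V`. -/
def fibreMap (g : V →ₗ[R] V) : Fibre R V →ₗ[R] Fibre R V :=
  Submodule.mapQ _ _ g (by
    rw [← Submodule.map_le_iff_le_comap, Submodule.map_smul'']
    exact Submodule.smul_mono le_rfl le_top)

@[simp] theorem fibreMap_toFibre (g : V →ₗ[R] V) (v : V) :
    fibreMap g (toFibre v) = toFibre (g v) := rfl

@[simp] theorem fibreMap_id (x : Fibre R V) : fibreMap (LinearMap.id : V →ₗ[R] V) x = x := by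
  obtain ⟨v, rfl⟩ := toFibre_surjective x
  rfl

theorem fibreMap_mul (g h : V ≃ₗ[R] V) (x : Fibre R V) :
    fibreMap ((g * h : V ≃ₗ[R] V) : V →ₗ[R] V) x =
      fibreMap (g : V →ₗ[R] V) (fibreMap (h : V →ₗ[R] V) x) := by
  obtain ⟨v, rfl⟩ := toFibre_surjective x
  rfl

theorem form_mem_mul {I : Ideal R} (q : V →ₗ[R] V →ₗ[R] R) {v w : V}
    (hv : v ∈ (maximalIdeal R • ⊤ : Submodule R V)) (hw : ∀ u, q u w ∈ I) :
    q v w ∈ maximalIdeal R * I := by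
  have : (maximalIdeal R • ⊤ : Submodule R V) ≤
      Submodule.comap (q.flip w) (maximalIdeal R * I) := by
    rw [Submodule.smul_le]
    intro r hr u _
    simpa using Ideal.mul_mem_mul hr (hw u)
  exact this hv

/-- The form induced on the fibre by a symmetric bilinear form, valued in the residue field. -/
def fibreForm (q : V →ₗ[R] V →ₗ[R] R) (hq : ∀ v w, q v w = q w v) :
    Fibre R V →ₗ[R] Fibre R V →ₗ[R] ResidueField R :=
  descendBilin toFibre toFibre_surjective toFibre toFibre_surjective
    (q.compr₂ (Algebra.linearMap R (ResidueField R)))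
    (fun a ha b => by
      have := form_mem_mul (I := ⊤) q (toFibre_eq_zero.1 ha) (w := b) (fun _ => trivial)
      rw [Ideal.mul_top] at this
      simpa [residue_eq_zero_iff] using this)
    (fun b hb a => by
      have := form_mem_mul (I := ⊤) q (toFibre_eq_zero.1 hb) (w := a) (fun _ => trivial)
      rw [Ideal.mul_top] at this
      simpa [residue_eq_zero_iff, hq a b] using this)

theorem fibreForm_apply (q : V →ₗ[R] V →ₗ[R] R) (hq : ∀ v w, q v w = q w v) (v w : V) :
    fibreForm q hq (toFibre v) (toFibre w) = residue R (q v w) :=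
  descendBilin_apply _ _ _ _ _ _ _ _ _

/-- The kernel of `q_x : V_x → V_x^*`. -/
def radical (q : V →ₗ[R] V →ₗ[R] R) (hq : ∀ v w, q v w = q w v) : Submodule R (Fibre R V) :=
  LinearMap.ker (fibreForm q hq)

theorem toFibre_mem_radical {q : V →ₗ[R] V →ₗ[R] R} {hq : ∀ v w, q v w = q w v} {v : V} :
    toFibre v ∈ radical q hq ↔ ∀ w, q v w ∈ maximalIdeal R := by
  rw [radical, LinearMap.mem_ker]
  constructor
  · intro h w
    rw [← residue_eq_zero_iff, ← fibreForm_apply q hq, h]; rfl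
  · intro h
    refine LinearMap.ext fun x => ?_
    obtain ⟨w, rfl⟩ := toFibre_surjective x
    rw [fibreForm_apply, (residue_eq_zero_iff _).2 (h w)]; rfl

/-- The sections of `V` whose value at `x` lies in the kernel of `q_x`. -/
def radicalSections (q : V →ₗ[R] V →ₗ[R] R) (hq : ∀ v w, q v w = q w v) : Submodule R V :=
  (radical q hq).comap toFibre

/-- Evaluation of the sections of `V` whose value at `x` lies in the kernel of `q_x`. -/
def toRadical (q : V →ₗ[R] V →ₗ[R] R) (hq : ∀ v w, q v w = q w v) :
    radicalSections q hq →ₗ[R] radical q hq :=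
  toFibre.restrict (fun _ hv => hv)

theorem toRadical_surjective (q : V →ₗ[R] V →ₗ[R] R) (hq : ∀ v w, q v w = q w v) :
    Function.Surjective (toRadical q hq) := by
  rintro ⟨x, hx⟩
  obtain ⟨v, rfl⟩ := toFibre_surjective x
  exact ⟨⟨v, hx⟩, rfl⟩

/-- The form `q_{1,x}` induced by `q` on the kernel of `q_x`: on the sections `v, w` of `V` with
value in the kernel, `q v w` lies in `m_x`, and `q_{1,x}` is its class in `m_x / m_x²`, the fibre of
`O(-x)` at `x`. -/
def radicalForm (q : V →ₗ[R] V →ₗ[R] R) (hq : ∀ v w, q v w = q w v) :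
    radical q hq →ₗ[R] radical q hq →ₗ[R] (maximalIdeal R).Cotangent :=
  descendBilin (toRadical q hq) (toRadical_surjective q hq) (toRadical q hq)
    (toRadical_surjective q hq)
    (LinearMap.mk₂ R
      (fun v w : radicalSections q hq =>
        (maximalIdeal R).toCotangent ⟨q v w, toFibre_mem_radical.1 v.2 w⟩)
      (fun v v' w => by rw [← map_add]; congr 1; ext; simp)
      (fun r v w => by rw [← map_smul]; congr 1; ext; simp)
      (fun v w w' => by rw [← map_add]; congr 1; ext; simp)
      (fun r v w => by rw [← map_smul]; congr 1; ext; simp))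
    (fun v hv w => by
      rw [LinearMap.mk₂_apply, Ideal.toCotangent_eq_zero, pow_two]
      exact form_mem_mul q (toFibre_eq_zero.1 (congrArg Subtype.val hv))
        (fun u => hq _ _ ▸ toFibre_mem_radical.1 w.2 u))
    (fun w hw v => by
      rw [LinearMap.mk₂_apply, Ideal.toCotangent_eq_zero, pow_two]
      show q v w ∈ _
      rw [hq]
      exact form_mem_mul q (toFibre_eq_zero.1 (congrArg Subtype.val hw))
        (fun u => hq _ _ ▸ toFibre_mem_radical.1 v.2 u))

theorem radicalForm_apply (q : V →ₗ[R] V →ₗ[R] R) (hq : ∀ v w, q v w = q w v)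
    (v w : radicalSections q hq) :
    radicalForm q hq (toRadical q hq v) (toRadical q hq w) =
      (maximalIdeal R).toCotangent ⟨q v w, toFibre_mem_radical.1 v.2 w⟩ :=
  descendBilin_apply _ _ _ _ _ _ _ _ _

theorem radicalForm_eq_zero_iff (q : V →ₗ[R] V →ₗ[R] R) (hq : ∀ v w, q v w = q w v) {v w : V}
    (hv : toFibre v ∈ radical q hq) (hw : toFibre w ∈ radical q hq) :
    radicalForm q hq ⟨toFibre v, hv⟩ ⟨toFibre w, hw⟩ = 0 ↔ q v w ∈ maximalIdeal R ^ 2 := by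
  have := radicalForm_apply q hq ⟨v, hv⟩ ⟨w, hw⟩
  change radicalForm q hq ⟨toFibre v, hv⟩ ⟨toFibre w, hw⟩ = _ at this
  rw [this, Ideal.toCotangent_eq_zero]

theorem radicalForm_symm (q : V →ₗ[R] V →ₗ[R] R) (hq : ∀ v w, q v w = q w v)
    (x y : radical q hq) : radicalForm q hq x y = radicalForm q hq y x := by
  obtain ⟨v, rfl⟩ := toRadical_surjective q hq x
  obtain ⟨w, rfl⟩ := toRadical_surjective q hq y
  rw [radicalForm_apply, radicalForm_apply]
  congr 1; ext; exact hq _ _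

end Fibre

/-- A degenerate orthogonal bundle with flags (with values in the trivial line bundle), locally at
a point `x` of its flag locus: `R` is the local ring at `x` and `V` the free module of germs of
sections at `x`.
* `singular`: the cokernel of `V → V^*` is killed by `m_x`, i.e. the singularities of the form
  have order at most one;
* the flag is `0 = F^{m+1} ⊊ F^m ⊊ ⋯ ⊊ F^1 ⊆ F^0 = V_x`, where `m = length`, and `F^1` is the kernel
  of the form on the fibre;
* `nondegenerate`: the induced form on `F^1` with values in the fibre of `O(-x)` at `x` is
  non-degenerate;
* `orthogonal`: `F^{m+2-i}` is the orthogonal complement of `F^i` in `F^1`. -/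
structure DegenerateOrthogonal (R V : Type*) [CommRing R] [IsDomain R]
    [IsDiscreteValuationRing R] [AddCommGroup V] [Module R V] [Module.Free R V]
    [Module.Finite R V] where
  form : V →ₗ[R] V →ₗ[R] R
  symm : ∀ v w, form v w = form w v
  singular : ∀ a ∈ maximalIdeal R, ∀ f : V →ₗ[R] R, ∃ v, form v = a • f
  length : ℕ
  flag : ℕ → Submodule R (Fibre R V)
  flag_zero : flag 0 = ⊤
  flag_one : flag 1 = radical form symm
  flag_lt : ∀ i, 1 ≤ i → i ≤ length → flag (i + 1) < flag i
  flag_bot : ∀ i, length < i → flag i = ⊥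
  nondegenerate : ∀ x, (∀ y, radicalForm form symm x y = 0) → x = 0
  orthogonal : ∀ i j, 1 ≤ i → 1 ≤ j → i + j = length + 2 → ∀ x : radical form symm,
    (x : Fibre R V) ∈ flag j ↔
      ∀ y : radical form symm, (y : Fibre R V) ∈ flag i → radicalForm form symm x y = 0

namespace DegenerateOrthogonal

variable {R V : Type*} [CommRing R] [IsDomain R] [IsDiscreteValuationRing R] [AddCommGroup V]
  [Module R V] [Module.Free R V] [Module.Finite R V] (E : DegenerateOrthogonal R V)

theorem flag_succ_le (i : ℕ) : E.flag (i + 1) ≤ E.flag i := by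
  rcases Nat.eq_zero_or_pos i with rfl | hi
  · rw [E.flag_zero]; exact le_top
  · by_cases h : i ≤ E.length
    · exact (E.flag_lt i hi h).le
    · rw [E.flag_bot (i + 1) (by omega)]; exact bot_le

theorem flag_antitone : Antitone E.flag := antitone_nat_of_succ_le E.flag_succ_le

theorem flag_le_radical {i : ℕ} (hi : 1 ≤ i) : E.flag i ≤ radical E.form E.symm :=
  E.flag_one ▸ E.flag_antitone hi

/-- The graded piece `G^i = F^i / F^{i+1}` of the flag. -/
abbrev Graded (i : ℕ) : Type _ := E.flag i ⧸ (E.flag (i + 1)).submoduleOf (E.flag i)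

/-- The class in `G^i` of a vector of `F^i`. -/
def toGraded (i : ℕ) : E.flag i →ₗ[R] E.Graded i := Submodule.mkQ _

theorem toGraded_surjective (i : ℕ) : Function.Surjective (E.toGraded i) :=
  Submodule.mkQ_surjective _

theorem toGraded_eq_zero {i : ℕ} {x : E.flag i} :
    E.toGraded i x = 0 ↔ (x : Fibre R V) ∈ E.flag (i + 1) :=
  Submodule.Quotient.mk_eq_zero _

/-- The pairing `q_{i,x} : G^i × G^j → m_x / m_x²`, for `i, j ≥ 1` with `i + j = m + 1`, induced by
the form on `F^1`. -/
def pairing (i j : ℕ) (hi : 1 ≤ i) (hj : 1 ≤ j) (hij : i + j = E.length + 1) :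
    E.Graded i →ₗ[R] E.Graded j →ₗ[R] (maximalIdeal R).Cotangent :=
  descendBilin (E.toGraded i) (E.toGraded_surjective i) (E.toGraded j) (E.toGraded_surjective j)
    ((radicalForm E.form E.symm).compl₁₂ (Submodule.inclusion (E.flag_le_radical hi))
      (Submodule.inclusion (E.flag_le_radical hj)))
    (fun a ha b =>
      (E.orthogonal j (i + 1) hj (by omega) (by omega)
        (Submodule.inclusion (E.flag_le_radical hi) a)).1 (E.toGraded_eq_zero.1 ha) _ b.2)
    (fun b hb a => by
      rw [LinearMap.compl₁₂_apply, radicalForm_symm]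
      exact (E.orthogonal i (j + 1) hi (by omega) (by omega)
        (Submodule.inclusion (E.flag_le_radical hj) b)).1 (E.toGraded_eq_zero.1 hb) _ a.2)

/-- The bilinear form on `G^0 = V_x / F^1` induced by the form on the fibre. -/
def zeroForm : E.Graded 0 →ₗ[R] E.Graded 0 →ₗ[R] ResidueField R :=
  descendBilin (E.toGraded 0) (E.toGraded_surjective 0) (E.toGraded 0) (E.toGraded_surjective 0)
    ((fibreForm E.form E.symm).compl₁₂ (E.flag 0).subtype (E.flag 0).subtype)
    (fun a ha b => by
      have h : (a : Fibre R V) ∈ radical E.form E.symm := E.flag_one ▸ E.toGraded_eq_zero.1 ha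
      rw [LinearMap.compl₁₂_apply, Submodule.subtype_apply, LinearMap.mem_ker.1 h]
      rfl)
    (fun b hb a => by
      have h : (b : Fibre R V) ∈ radical E.form E.symm := E.flag_one ▸ E.toGraded_eq_zero.1 hb
      have hs : ∀ x y, fibreForm E.form E.symm x y = fibreForm E.form E.symm y x := by
        intro x y
        obtain ⟨v, rfl⟩ := toFibre_surjective x
        obtain ⟨w, rfl⟩ := toFibre_surjective y
        rw [fibreForm_apply, fibreForm_apply, E.symm]
      rw [LinearMap.compl₁₂_apply, hs, Submodule.subtype_apply, LinearMap.mem_ker.1 h]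
      rfl)

/-- The quadratic form `q_{0,x}` on `G^0`. -/
def zeroQuadratic : QuadraticMap R (E.Graded 0) (ResidueField R) :=
  LinearMap.BilinMap.toQuadraticMap E.zeroForm

/-- The quadratic form `q_{(1+m)/2,x}` on the middle piece `G^i`, `i = (1 + m)/2`, for `m` odd. -/
def middleQuadratic (i : ℕ) (hi : 1 ≤ i) (him : i + i = E.length + 1) :
    QuadraticMap R (E.Graded i) (maximalIdeal R).Cotangent :=
  LinearMap.BilinMap.toQuadraticMap (E.pairing i i hi hi him)

/-- `g` preserves every step of the flag. -/
def PreservesFlag (g : V ≃ₗ[R] V) : Prop :=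
  ∀ i, (E.flag i).map (fibreMap (g : V →ₗ[R] V)) = E.flag i

variable {E} in
theorem PreservesFlag.mem {g : V ≃ₗ[R] V} (h : E.PreservesFlag g) (i : ℕ) {x : Fibre R V}
    (hx : x ∈ E.flag i) : fibreMap (g : V →ₗ[R] V) x ∈ E.flag i :=
  h i ▸ Submodule.mem_map_of_mem hx

variable {E} in
/-- The endomorphism of `G^i` induced by an automorphism that preserves the flag. -/
def PreservesFlag.graded {g : V ≃ₗ[R] V} (h : E.PreservesFlag g) (i : ℕ) :
    E.Graded i →ₗ[R] E.Graded i :=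
  Submodule.mapQ _ _ ((fibreMap (g : V →ₗ[R] V)).restrict (fun _ hx => h.mem i hx))
    (fun _ hx => h.mem (i + 1) hx)

/-- `g` preserves the form, the flag, the pairings between graded pieces, and the quadratic forms on
`G^0` and on the middle piece. -/
structure IsAut (g : V ≃ₗ[R] V) : Prop where
  form : ∀ v w, E.form (g v) (g w) = E.form v w
  flag : E.PreservesFlag g
  pairing : ∀ i j hi hj hij x y,
    E.pairing i j hi hj hij (flag.graded i x) (flag.graded j y) = E.pairing i j hi hj hij x y
  zero : ∀ x, E.zeroQuadratic (flag.graded 0 x) = E.zeroQuadratic x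
  middle : ∀ i hi him x,
    E.middleQuadratic i hi him (flag.graded i x) = E.middleQuadratic i hi him x

variable {E}

theorem PreservesFlag.one : E.PreservesFlag 1 := fun i => by
  ext x
  simp [Submodule.mem_map]

theorem PreservesFlag.mul {g h : V ≃ₗ[R] V} (hg : E.PreservesFlag g) (hh : E.PreservesFlag h) :
    E.PreservesFlag (g * h) := fun i => by
  conv_rhs => rw [← hg i, ← hh i, ← Submodule.map_comp]
  congr 1
  ext x
  rfl

theorem PreservesFlag.inv {g : V ≃ₗ[R] V} (hg : E.PreservesFlag g) : E.PreservesFlag g⁻¹ :=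
  fun i => by
  conv_lhs => rw [← hg i, ← Submodule.map_comp]
  ext x
  simp [Submodule.mem_map, ← fibreMap_mul]

theorem PreservesFlag.graded_one (i : ℕ) (x : E.Graded i) :
    (PreservesFlag.one : E.PreservesFlag 1).graded i x = x := by
  obtain ⟨⟨y, hy⟩, rfl⟩ := E.toGraded_surjective i x
  exact congrArg (E.toGraded i) (Subtype.ext (fibreMap_id y))

theorem PreservesFlag.graded_mul {g h : V ≃ₗ[R] V} (hg : E.PreservesFlag g)
    (hh : E.PreservesFlag h) (hgh : E.PreservesFlag (g * h)) (i : ℕ) (x : E.Graded i) :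
    hgh.graded i x = hg.graded i (hh.graded i x) := by
  obtain ⟨⟨y, hy⟩, rfl⟩ := E.toGraded_surjective i x
  exact congrArg (E.toGraded i) (Subtype.ext (fibreMap_mul g h y))

theorem PreservesFlag.graded_inv {g : V ≃ₗ[R] V} (hg : E.PreservesFlag g) (i : ℕ)
    (x : E.Graded i) : hg.graded i (hg.inv.graded i x) = x := by
  rw [← PreservesFlag.graded_mul hg hg.inv (hg.mul hg.inv)]
  obtain ⟨⟨y, hy⟩, rfl⟩ := E.toGraded_surjective i x
  refine congrArg (E.toGraded i) (Subtype.ext ?_)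
  simp [LinearMap.restrict_apply]

variable (E)

/-- The group `Aut_x(V, q, F)` of local automorphisms: the elements of `GL(V)` that preserve the
form, the flag, the pairings between graded pieces, and the quadratic forms on `G^0` and on the
middle piece. -/
def autGroup : Subgroup (V ≃ₗ[R] V) where
  carrier := {g | E.IsAut g}
  one_mem' :=
    { form := fun _ _ => rfl
      flag := .one
      pairing := fun i j hi hj hij x y => by
        rw [PreservesFlag.graded_one, PreservesFlag.graded_one]
      zero := fun x => by rw [PreservesFlag.graded_one]
      middle := fun i hi him x => by rw [PreservesFlag.graded_one] }
  mul_mem' := fun {g h} hg hh =>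
    { form := fun v w => (hg.form _ _).trans (hh.form _ _)
      flag := hg.flag.mul hh.flag
      pairing := fun i j hi hj hij x y => by
        rw [PreservesFlag.graded_mul hg.flag hh.flag, PreservesFlag.graded_mul hg.flag hh.flag,
          hg.pairing, hh.pairing]
      zero := fun x => by
        rw [PreservesFlag.graded_mul hg.flag hh.flag, hg.zero, hh.zero]
      middle := fun i hi him x => by
        rw [PreservesFlag.graded_mul hg.flag hh.flag, hg.middle, hh.middle] }
  inv_mem' := fun {g} hg =>
    { form := fun v w => by
        rw [← hg.form]
        exact congrArg₂ (fun a b => E.form a b) (g.apply_symm_apply v) (g.apply_symm_apply w)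
      flag := hg.flag.inv
      pairing := fun i j hi hj hij x y => by
        rw [← hg.pairing, PreservesFlag.graded_inv, PreservesFlag.graded_inv]
      zero := fun x => by rw [← hg.zero, PreservesFlag.graded_inv]
      middle := fun i hi him x => by rw [← hg.middle, PreservesFlag.graded_inv] }

end DegenerateOrthogonal


/-- The germ at `y` of a `Γ`-equivariant vector bundle `W` with an everywhere non-degenerate
`Γ`-invariant quadratic form, written as the symmetric bilinear form `form`: `S` is the local ring
at `y`, `Γ` is the isotropy group of `y`, and `W` is the `S`-module of germs of sections. -/
structure GammaOrthogonal (Γ S W : Type*) [Group Γ] [CommRing S] [MulSemiringAction Γ S]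
    [AddCommGroup W] [Module S W] [DistribMulAction Γ W] where
  form : W →ₗ[S] W →ₗ[S] S
  symm : ∀ v w, form v w = form w v
  nondegenerate : Function.Bijective form
  semilinear : ∀ (γ : Γ) (a : S) (w : W), γ • (a • w) = (γ • a) • (γ • w)
  form_smul : ∀ (γ : Γ) (v w : W), form (γ • v) (γ • w) = γ • form v w

namespace GammaOrthogonal

section Group

variable {Γ S W : Type*} [Group Γ] [CommRing S] [MulSemiringAction Γ S] [AddCommGroup W]
  [Module S W] [DistribMulAction Γ W] (D : GammaOrthogonal Γ S W)

/-- The group `O_n(O_y)^{Γ_y}` of automorphisms of the `S`-module `W` that preserve the form and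
commute with `Γ`. -/
def autGroup : Subgroup (W ≃ₗ[S] W) where
  carrier := {θ | (∀ v w, D.form (θ v) (θ w) = D.form v w) ∧ ∀ (γ : Γ) w, θ (γ • w) = γ • θ w}
  one_mem' := ⟨fun _ _ => rfl, fun _ _ => rfl⟩
  mul_mem' := fun {θ η} hθ hη =>
    ⟨fun v w => (hθ.1 _ _).trans (hη.1 _ _),
      fun γ w => (congrArg θ (hη.2 γ w)).trans (hθ.2 γ _)⟩
  inv_mem' := fun {θ} hθ =>
    ⟨fun v w => by
      rw [← hθ.1]
      exact congrArg₂ (fun a b => D.form a b) (θ.apply_symm_apply v) (θ.apply_symm_apply w),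
      fun γ w => by
      apply θ.injective
      rw [hθ.2]
      exact (θ.apply_symm_apply _).trans (congrArg (γ • ·) (θ.apply_symm_apply w)).symm⟩

end Group

theorem torsionFree (R S W : Type*) [CommRing R] [IsDomain R] [CommRing S] [IsDomain S]
    [Algebra R S] [FaithfulSMul R S] [AddCommGroup W] [Module S W] [Module.Free S W] [Module R W]
    [IsScalarTower R S W] : Module.IsTorsionFree R W :=
  .trans_faithfulSMul R S W

variable {Γ S W : Type*} (R : Type*) [Group Γ] [CommRing R] [CommRing S] [Algebra R S]
  [MulSemiringAction Γ S] [IsGaloisGroup Γ R S] [AddCommGroup W] [Module S W] [Module R W]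
  [IsScalarTower R S W] [DistribMulAction Γ W] (D : GammaOrthogonal Γ S W)

theorem smul_base_smul (D : GammaOrthogonal Γ S W) (γ : Γ) (r : R) (w : W) :
    γ • (r • w) = r • (γ • w) := by
  have : SMulCommClass Γ R S := IsGaloisGroup.commutes
  rw [← algebraMap_smul S r w, D.semilinear, smul_algebraMap, algebraMap_smul]

/-- The module `V = W^Γ` of invariants, over the local ring `R = S^Γ` of the quotient. -/
def invariants : Submodule R W where
  carrier := {w | ∀ γ : Γ, γ • w = w}
  add_mem' := fun ha hb γ => by rw [smul_add, ha γ, hb γ]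
  zero_mem' := fun γ => smul_zero γ
  smul_mem' := fun r w hw γ => by rw [D.smul_base_smul R, hw γ]

theorem exists_base_form (v w : D.invariants R) :
    ∃ r : R, algebraMap R S r = D.form v w := by
  have : Algebra.IsInvariant R S Γ := IsGaloisGroup.isInvariant
  refine Algebra.IsInvariant.isInvariant (G := Γ) _ (fun γ => ?_)
  rw [← D.form_smul, v.2 γ, w.2 γ]

variable [FaithfulSMul R S]

/-- The form `q` on `V = W^Γ` induced by the form on `W`; its values lie in `S^Γ = R`. -/
def baseForm : D.invariants R →ₗ[R] D.invariants R →ₗ[R] R :=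
  LinearMap.mk₂ R (fun v w => (D.exists_base_form R v w).choose)
    (fun v v' w => FaithfulSMul.algebraMap_injective R S (by
      rw [map_add, (D.exists_base_form R _ _).choose_spec, (D.exists_base_form R _ _).choose_spec,
        (D.exists_base_form R _ _).choose_spec, Submodule.coe_add, map_add, LinearMap.add_apply]))
    (fun r v w => FaithfulSMul.algebraMap_injective R S (by
      rw [smul_eq_mul, map_mul, (D.exists_base_form R _ _).choose_spec,
        (D.exists_base_form R _ _).choose_spec, Submodule.coe_smul,
        ← algebraMap_smul S r (v : W), map_smul, LinearMap.smul_apply, smul_eq_mul]))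
    (fun v w w' => FaithfulSMul.algebraMap_injective R S (by
      rw [map_add, (D.exists_base_form R _ _).choose_spec, (D.exists_base_form R _ _).choose_spec,
        (D.exists_base_form R _ _).choose_spec, Submodule.coe_add, map_add]))
    (fun r v w => FaithfulSMul.algebraMap_injective R S (by
      rw [smul_eq_mul, map_mul, (D.exists_base_form R _ _).choose_spec,
        (D.exists_base_form R _ _).choose_spec, Submodule.coe_smul,
        ← algebraMap_smul S r (w : W), map_smul, smul_eq_mul]))

theorem algebraMap_baseForm (v w : D.invariants R) :
    algebraMap R S (D.baseForm R v w) = D.form v w :=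
  (D.exists_base_form R v w).choose_spec

theorem baseForm_symm (v w : D.invariants R) : D.baseForm R v w = D.baseForm R w v :=
  FaithfulSMul.algebraMap_injective R S (by
    rw [algebraMap_baseForm, algebraMap_baseForm, D.symm])

variable [IsDomain R] [IsDiscreteValuationRing R] [IsDomain S] [IsDiscreteValuationRing S]

/-- The submodule `V ∩ m_y^c W` of `V = W^Γ`. -/
def sections (c : ℕ) : Submodule R (D.invariants R) :=
  ((maximalIdeal S ^ c • ⊤ : Submodule S W).restrictScalars R).comap (D.invariants R).subtype

/-- The subspace `F_y^c` of the fibre `V_x`: the values at `x` of the invariant sections of `W` that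
vanish to order at least `c` at `y`. -/
def fullFlag (c : ℕ) : Submodule R (Fibre R (D.invariants R)) :=
  (D.sections R c).map toFibre

/-- The `c ≥ 1` with `F_y^{c+1} ≠ F_y^c`; the numbers `c / |Γ|` are the parabolic weights. -/
def jumps : Set ℕ := {c | 1 ≤ c ∧ D.fullFlag R (c + 1) ≠ D.fullFlag R c}

variable {R} in
theorem mem_sections {t : S} (ht : Irreducible t) {c : ℕ} {v : D.invariants R} :
    v ∈ D.sections R c ↔ ∃ w : W, t ^ c • w = v := by
  change (v : W) ∈ (maximalIdeal S ^ c • ⊤ : Submodule S W) ↔ _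
  rw [ht.maximalIdeal_eq, Ideal.span_singleton_pow, Submodule.ideal_span_singleton_smul,
    Submodule.mem_smul_pointwise_iff_exists]
  simp

theorem sections_antitone : Antitone (D.sections R) := fun _ _ h _ hv =>
  Submodule.smul_mono_left (Ideal.pow_le_pow_right h) hv

theorem fullFlag_antitone : Antitone (D.fullFlag R) := fun _ _ h =>
  Submodule.map_mono (D.sections_antitone R h)

/-- Uniformizers `s` of `R` and `t` of `S` with `s = t ^ e * δ`, `δ` a unit. -/
structure Ramified (s : R) (t δ : S) (e : ℕ) : Prop where
  irr : Irreducible s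
  irr' : Irreducible t
  unit : IsUnit δ
  pos : 1 ≤ e
  eq : algebraMap R S s = t ^ e * δ

theorem isUnit_of_algebraMap (hΓ : IsGaloisGroup Γ R S) {r : R} (h : IsUnit (algebraMap R S r)) :
    IsUnit r := by
  have : Algebra.IsInvariant R S Γ := IsGaloisGroup.isInvariant
  have : SMulCommClass Γ R S := IsGaloisGroup.commutes
  obtain ⟨b, hb⟩ := h.exists_right_inv
  obtain ⟨r', rfl⟩ := Algebra.IsInvariant.isInvariant (A := R) (G := Γ) b (fun γ => by
    apply h.mul_left_cancel
    have := congrArg (γ • ·) hb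
    simp only [smul_mul', smul_algebraMap, smul_one] at this
    rw [this, hb])
  rw [← map_mul, ← map_one (algebraMap R S)] at hb
  exact IsUnit.of_mul_eq_one _ (FaithfulSMul.algebraMap_injective R S hb)

theorem exists_ramified (hΓ : IsGaloisGroup Γ R S) :
    ∃ (s : R) (t δ : S) (e : ℕ), Ramified R s t δ e := by
  obtain ⟨s, hs⟩ := IsDiscreteValuationRing.exists_irreducible R
  obtain ⟨t, ht⟩ := IsDiscreteValuationRing.exists_irreducible S
  have h0 : algebraMap R S s ≠ 0 := fun h =>
    hs.ne_zero (FaithfulSMul.algebraMap_injective R S (h.trans (map_zero _).symm))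
  obtain ⟨e, u, hu⟩ := IsDiscreteValuationRing.eq_unit_mul_pow_irreducible h0 ht
  refine ⟨s, t, u, e, hs, ht, u.isUnit, ?_, by rw [hu, mul_comm]⟩
  rcases Nat.eq_zero_or_pos e with rfl | h
  · refine absurd (isUnit_of_algebraMap R hΓ ?_) hs.not_isUnit
    rw [hu]; simp
  · exact h

variable {R} {D}

section

variable {s : R} {t δ : S} {e : ℕ}

theorem Ramified.mem_maximalIdeal (H : Ramified R s t δ e) {r : R} :
    r ∈ maximalIdeal R ↔ ∃ r', r = s * r' := by
  rw [H.irr.maximalIdeal_eq, Ideal.mem_span_singleton]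
  rfl

theorem Ramified.mem_sq (H : Ramified R s t δ e) {r : R} :
    r ∈ maximalIdeal R ^ 2 ↔ ∃ r', r = s ^ 2 * r' := by
  rw [H.irr.maximalIdeal_eq, Ideal.span_singleton_pow, Ideal.mem_span_singleton]
  rfl

theorem Ramified.mem_maximalIdeal_of_dvd (H : Ramified R s t δ e) (hΓ : IsGaloisGroup Γ R S)
    {r : R} (h : t ∣ algebraMap R S r) : r ∈ maximalIdeal R := by
  rw [IsLocalRing.mem_maximalIdeal, mem_nonunits_iff]
  exact fun hr => H.irr'.not_isUnit (isUnit_of_dvd_unit h (hr.map (algebraMap R S)))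

theorem Ramified.mem_sq_of_dvd (H : Ramified R s t δ e) (hΓ : IsGaloisGroup Γ R S) {r : R}
    (h : t ^ (e + 1) ∣ algebraMap R S r) : r ∈ maximalIdeal R ^ 2 := by
  obtain ⟨r', rfl⟩ := H.mem_maximalIdeal.1
    (H.mem_maximalIdeal_of_dvd hΓ ((dvd_pow_self t (Nat.succ_ne_zero e)).trans h))
  rw [pow_two]
  refine Ideal.mul_mem_mul (H.mem_maximalIdeal.2 ⟨1, by simp⟩) (H.mem_maximalIdeal_of_dvd hΓ ?_)
  rw [map_mul, H.eq, pow_succ, mul_assoc,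
    mul_dvd_mul_iff_left (pow_ne_zero _ H.irr'.ne_zero)] at h
  exact (H.unit.dvd_mul_left).1 h

theorem Ramified.not_mem_sq (H : Ramified R s t δ e) : s ∉ maximalIdeal R ^ 2 := by
  rw [H.mem_sq]
  rintro ⟨r', h⟩
  apply H.irr.not_isUnit
  refine IsUnit.of_mul_eq_one r' (mul_left_cancel₀ H.irr.ne_zero ?_)
  rw [mul_one, ← mul_assoc, ← pow_two]
  exact h.symm

theorem Ramified.dvd_form (H : Ramified R s t δ e) {c d : ℕ} {v w : D.invariants R}
    (hv : v ∈ D.sections R c) (hw : w ∈ D.sections R d) :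
    t ^ (c + d) ∣ algebraMap R S (D.baseForm R v w) := by
  obtain ⟨v', hv⟩ := (mem_sections D H.irr').1 hv
  obtain ⟨w', hw⟩ := (mem_sections D H.irr').1 hw
  rw [algebraMap_baseForm, ← hv, ← hw, map_smul, map_smul, LinearMap.smul_apply, smul_eq_mul,
    smul_eq_mul, pow_add]
  exact ⟨D.form v' w', by ring⟩

variable [Module.Free S W] [Module.Finite S W]

theorem mem_smul_top (H : Ramified R s t δ e) {v : D.invariants R} :
    v ∈ (maximalIdeal R • ⊤ : Submodule R (D.invariants R)) ↔ ∃ w, v = s • w := by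
  rw [H.irr.maximalIdeal_eq, Submodule.ideal_span_singleton_smul,
    Submodule.mem_smul_pointwise_iff_exists]
  simp [eq_comm]

theorem mem_sections_e (H : Ramified R s t δ e) {v : D.invariants R} :
    v ∈ D.sections R e ↔ v ∈ (maximalIdeal R • ⊤ : Submodule R (D.invariants R)) := by
  rw [mem_smul_top H, mem_sections D H.irr']
  have := torsionFree R S W
  constructor
  · rintro ⟨w, hw⟩
    obtain ⟨ε, hε⟩ := H.unit.exists_right_inv
    have h1 : s • (ε • w) = (v : W) := by
      rw [← algebraMap_smul S s, H.eq, smul_smul, mul_assoc, hε, mul_one, hw]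
    refine ⟨⟨ε • w, fun γ => ?_⟩, Subtype.ext h1.symm⟩
    apply smul_right_injective W H.irr.ne_zero
    change s • γ • ε • w = s • ε • w
    rw [← D.smul_base_smul R, h1, v.2 γ]
  · rintro ⟨w, rfl⟩
    refine ⟨δ • (w : W), ?_⟩
    rw [smul_smul, ← H.eq, algebraMap_smul]
    rfl

/-- Existence of invariant sections with prescribed value of the form. -/
theorem exists_form_eq [Finite Γ] [Algebra ℂ R] (H : Ramified R s t δ e) {c k : ℕ}
    {v : D.invariants R} (hv : v ∈ D.sections R c) (hv' : v ∉ D.sections R (c + 1)) (a : R) (η : S)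
    (ha : algebraMap R S a = t ^ (c + k) * η) :
    ∃ v' ∈ D.sections R k, D.baseForm R v v' = a := by
  classical
  have := Fintype.ofFinite Γ
  have : SMulCommClass Γ R S := IsGaloisGroup.commutes
  obtain ⟨w, hw⟩ := (mem_sections D H.irr').1 hv
  let b := Module.Free.chooseBasis S W
  obtain ⟨i, hi⟩ : ∃ i, IsUnit (b.coord i w) := by
    by_contra! hcon
    apply hv'
    have h2 : ∀ i, ∃ x, b.coord i w = t * x := fun i => by
      have : b.coord i w ∈ maximalIdeal S := hcon i
      rwa [H.irr'.maximalIdeal_eq, Ideal.mem_span_singleton] at this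
    choose x hx using h2
    refine (mem_sections D H.irr').2 ⟨∑ i, x i • b i, ?_⟩
    rw [← hw, pow_succ, mul_smul]
    congr 1
    conv_rhs => rw [← b.sum_repr w]
    rw [Finset.smul_sum]
    refine Finset.sum_congr rfl fun i _ => ?_
    rw [smul_smul, ← hx i]
    rfl
  obtain ⟨u, hu⟩ := D.nondegenerate.2 (b.coord i)
  obtain ⟨ε, hε⟩ := hi.exists_right_inv
  have hu' : D.form w ((ε * η) • u) = η := by
    rw [map_smul, D.symm, hu, smul_eq_mul, mul_right_comm, mul_comm ε, hε, one_mul]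
  set u' := (ε * η) • u with hu'def
  have hvu : ∀ γ : Γ, D.form v (γ • t ^ k • u') = algebraMap R S a := fun γ => by
    have h3 : D.form v (t ^ k • u') = algebraMap R S a := by
      rw [← hw, LinearMap.map_smul, LinearMap.map_smul₂, hu', ha, pow_add, smul_eq_mul, smul_eq_mul]
      ring
    conv_lhs => rw [← v.2 γ]
    rw [D.form_smul, h3, smul_algebraMap]
  let N : W := ∑ γ : Γ, γ • t ^ k • u'
  let r : R := algebraMap ℂ R (Fintype.card Γ : ℂ)⁻¹
  have hr : algebraMap R S r * (Fintype.card Γ : S) = 1 := by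
    have hc : (Fintype.card Γ : ℂ) ≠ 0 := by simp
    have : r * (Fintype.card Γ : R) = 1 := by
      rw [← map_natCast (algebraMap ℂ R), ← map_mul, inv_mul_cancel₀ hc, map_one]
    rw [← map_natCast (algebraMap R S), ← map_mul, this, map_one]
  have hN : ∀ γ : Γ, γ • N = N := fun γ => by
    simp only [N, Finset.smul_sum]
    exact Fintype.sum_equiv (Equiv.mulLeft γ) _ _ (fun _ => smul_smul _ _ _)
  refine ⟨⟨r • N, fun γ => by rw [D.smul_base_smul R, hN]⟩, ?_, ?_⟩
  · refine Submodule.smul_mem _ r (x := (⟨N, hN⟩ : D.invariants R)) ?_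
    change N ∈ (maximalIdeal S ^ k • ⊤ : Submodule S W)
    refine Submodule.sum_mem _ fun γ _ => ?_
    rw [D.semilinear]
    refine Submodule.smul_mem_smul ?_ trivial
    rw [smul_pow']
    refine Ideal.pow_mem_pow ?_ k
    rw [mem_maximalIdeal, mem_nonunits_iff]
    intro hun
    apply H.irr'.not_isUnit
    have := hun.map (MulSemiringAction.toRingHom Γ S γ⁻¹)
    simpa using this
  · apply FaithfulSMul.algebraMap_injective R S
    rw [algebraMap_baseForm]
    change D.form v (r • N) = _
    rw [← algebraMap_smul S r, map_smul]
    simp only [N, map_sum, hvu]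
    rw [Finset.sum_const, Finset.card_univ, smul_eq_mul, nsmul_eq_mul, ← mul_assoc, hr, one_mul]


variable [Finite Γ] [Algebra ℂ R]

theorem mem_fullFlag (H : Ramified R s t δ e) {c : ℕ} (hc : c ≤ e) {v : D.invariants R} :
    toFibre v ∈ D.fullFlag R c ↔ v ∈ D.sections R c := by
  constructor
  · rintro ⟨w, hw, hwv⟩
    have h1 : v - w ∈ D.sections R e := by
      rw [mem_sections_e H, ← toFibre_eq_zero, map_sub, hwv, sub_self]
    simpa using (D.sections R c).add_mem (D.sections_antitone R hc h1) hw
  · exact fun h => ⟨v, h, rfl⟩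

theorem fullFlag_eq_bot (H : Ramified R s t δ e) {c : ℕ} (hc : e ≤ c) : D.fullFlag R c = ⊥ := by
  rw [eq_bot_iff]
  refine (D.fullFlag_antitone R hc).trans ?_
  rintro _ ⟨v, hv, rfl⟩
  exact toFibre_eq_zero.2 ((mem_sections_e H).1 hv)

theorem exists_order {a b : ℕ} {v : D.invariants R} (ha : v ∈ D.sections R a)
    (hb : v ∉ D.sections R b) : ∃ c, a ≤ c ∧ c < b ∧ v ∈ D.sections R c ∧
      v ∉ D.sections R (c + 1) := by
  induction b with
  | zero => exact absurd (D.sections_antitone R (Nat.zero_le a) ha) hb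
  | succ b ih =>
    by_cases h : v ∈ D.sections R b
    · refine ⟨b, ?_, Nat.lt_succ_self b, h, hb⟩
      by_contra! hlt
      exact hb (D.sections_antitone R hlt ha)
    · obtain ⟨c, h1, h2, h3⟩ := ih h
      exact ⟨c, h1, h2.trans (Nat.lt_succ_self b), h3⟩

theorem mem_sections_zero (v : D.invariants R) : v ∈ D.sections R 0 := by
  change (v : W) ∈ (maximalIdeal S ^ 0 • ⊤ : Submodule S W)
  simp

theorem mem_radical_iff (H : Ramified R s t δ e) {v : D.invariants R} :
    toFibre v ∈ radical (D.baseForm R) (D.baseForm_symm R) ↔ v ∈ D.sections R 1 := by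
  rw [toFibre_mem_radical]
  constructor
  · intro h
    by_contra hv
    obtain ⟨w, -, hw⟩ := exists_form_eq H (c := 0) (k := 0) (mem_sections_zero v) hv 1 1 (by simp)
    have := h w
    rw [hw] at this
    exact (Ideal.ne_top_iff_one _).1 (maximalIdeal.isMaximal R).ne_top this
  · intro h w
    refine H.mem_maximalIdeal_of_dvd (Γ := Γ) ‹_› ?_
    simpa using H.dvd_form h (mem_sections_zero w)

theorem mem_orthogonal_iff (H : Ramified R s t δ e) {c : ℕ} (hc : 1 ≤ c) (hce : c ≤ e)
    {v : D.invariants R} (hv : v ∈ D.sections R 1) :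
    (∀ w ∈ D.sections R c, D.baseForm R v w ∈ maximalIdeal R ^ 2) ↔
      v ∈ D.sections R (e + 1 - c) := by
  constructor
  · intro h
    by_contra hv'
    obtain ⟨d, hd, hd', h1, h2⟩ := exists_order hv hv'
    obtain ⟨w, hw, hw'⟩ := exists_form_eq H (k := e - d) h1 h2 s δ
      (by rw [H.eq]; congr 2; omega)
    have := h w (D.sections_antitone R (by omega) hw)
    rw [hw'] at this
    exact H.not_mem_sq this
  · intro h w hw
    refine H.mem_sq_of_dvd (Γ := Γ) ‹_› ?_
    have := H.dvd_form h hw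
    rwa [show e + 1 - c + c = e + 1 by omega] at this

theorem mem_fullFlag_orthogonal (H : Ramified R s t δ e) {c : ℕ} (hc : 1 ≤ c) (hce : c ≤ e)
    (x : radical (D.baseForm R) (D.baseForm_symm R)) :
    (x : Fibre R (D.invariants R)) ∈ D.fullFlag R (e + 1 - c) ↔
      ∀ y : radical (D.baseForm R) (D.baseForm_symm R),
        (y : Fibre R (D.invariants R)) ∈ D.fullFlag R c →
          radicalForm (D.baseForm R) (D.baseForm_symm R) x y = 0 := by
  obtain ⟨x, hx⟩ := x
  obtain ⟨v, rfl⟩ := toFibre_surjective x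
  rw [mem_fullFlag H (by omega), ← mem_orthogonal_iff H hc hce ((mem_radical_iff H).1 hx)]
  constructor
  · rintro h ⟨y, hy⟩ hyc
    obtain ⟨w, rfl⟩ := toFibre_surjective y
    exact (radicalForm_eq_zero_iff _ _ hx hy).2 (h w ((mem_fullFlag H hce).1 hyc))
  · intro h w hw
    have hy := (mem_radical_iff H).2 (D.sections_antitone R hc hw)
    exact (radicalForm_eq_zero_iff _ _ hx hy).1 (h ⟨_, hy⟩ ((mem_fullFlag H hce).2 hw))

theorem mem_jumps_symm (H : Ramified R s t δ e) {c : ℕ} (h : c ∈ D.jumps R) :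
    c < e ∧ e - c ∈ D.jumps R := by
  obtain ⟨h1, h2⟩ := h
  have hce : c < e := by
    by_contra! hcon
    exact h2 (by rw [fullFlag_eq_bot H hcon, fullFlag_eq_bot H (hcon.trans (Nat.le_succ c))])
  refine ⟨hce, by omega, fun h => h2 ?_⟩
  have key : ∀ d, 1 ≤ d → D.fullFlag R d ≤ radical (D.baseForm R) (D.baseForm_symm R) := by
    rintro d hd _ ⟨v, hv, rfl⟩
    exact (mem_radical_iff H).2 (D.sections_antitone R hd hv)
  refine le_antisymm (D.fullFlag_antitone R (Nat.le_succ c)) fun x hx => ?_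
  have h3 := (mem_fullFlag_orthogonal H (c := e - c + 1) (by omega) (by omega)
    ⟨x, key c h1 hx⟩).1 (by rwa [show e + 1 - (e - c + 1) = c by omega])
  have h4 := (mem_fullFlag_orthogonal H (c := e - c) (by omega) (by omega)
    ⟨x, key c h1 hx⟩).2 (by rwa [← h])
  rwa [show e + 1 - (e - c) = c + 1 by omega] at h4

variable (R D)

theorem jumps_finite : (D.jumps R).Finite := by
  obtain ⟨s, t, δ, e, H⟩ := exists_ramified R (Γ := Γ) (S := S) ‹_›
  exact (Set.finite_Iio e).subset fun c hc => (mem_jumps_symm H hc).1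

/-- The number `m_x` of jumps. -/
def flagLength : ℕ := (D.jumps_finite R).toFinset.card

/-- The jumps in increasing order. -/
def jump : Fin (D.flagLength R) ↪o ℕ := (D.jumps_finite R).toFinset.orderEmbOfFin rfl

/-- The reduced flag: `F^0 = V_x`, and `F^1 ⊋ ⋯ ⊋ F^m` are the distinct non-zero subspaces among
the `F_y^c`, `c ≥ 1`. -/
def flag : ℕ → Submodule R (Fibre R (D.invariants R))
  | 0 => ⊤
  | i + 1 => if h : i < D.flagLength R then D.fullFlag R (D.jump R ⟨i, h⟩) else ⊥

variable {R D}

theorem jump_mem (i : Fin (D.flagLength R)) : D.jump R i ∈ D.jumps R :=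
  (D.jumps_finite R).mem_toFinset.1 (Finset.orderEmbOfFin_mem _ rfl i)

theorem exists_jump {c : ℕ} (hc : c ∈ D.jumps R) : ∃ i, D.jump R i = c := by
  exact (Finset.range_orderEmbOfFin (D.jumps_finite R).toFinset rfl).ge
    ((D.jumps_finite R).mem_toFinset.2 hc)

theorem fullFlag_eq_of_no_jump {a b : ℕ} (ha : 1 ≤ a) (hab : a ≤ b)
    (h : ∀ c ∈ D.jumps R, a ≤ c → b ≤ c) : D.fullFlag R a = D.fullFlag R b := by
  induction b, hab using Nat.le_induction with
  | base => rfl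
  | succ b hb ih =>
    rw [ih fun c hc hac => (Nat.le_succ b).trans (h c hc hac)]
    by_contra hne
    exact absurd (h b ⟨ha.trans hb, fun h => hne h.symm⟩ hb) (by omega)

theorem flag_succ_eq (H : Ramified R s t δ e) {c k : ℕ} (hc : 1 ≤ c) (hk : k ≤ D.flagLength R)
    (h1 : ∀ j : Fin (D.flagLength R), (j : ℕ) < k → D.jump R j < c)
    (h2 : ∀ j : Fin (D.flagLength R), k ≤ (j : ℕ) → c ≤ D.jump R j) :
    D.flag R (k + 1) = D.fullFlag R c := by
  rw [flag]
  split_ifs with hlt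
  · refine (fullFlag_eq_of_no_jump hc (h2 ⟨k, hlt⟩ le_rfl) fun d hd hcd => ?_).symm
    obtain ⟨j, rfl⟩ := exists_jump hd
    refine (D.jump R).monotone (Fin.le_def.2 ?_)
    by_contra! hjk
    exact absurd (h1 j hjk) (by omega)
  · rw [fullFlag_eq_of_no_jump hc (le_max_left c e), fullFlag_eq_bot H (le_max_right c e)]
    intro d hd hcd
    obtain ⟨j, rfl⟩ := exists_jump hd
    exact absurd (h1 j (by omega)) (by omega)

theorem jump_symm (H : Ramified R s t δ e) (i : Fin (D.flagLength R)) :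
    D.jump R i = e - D.jump R i.rev := by
  have aux : ∀ i j : Fin (D.flagLength R), i < j → e - D.jump R i.rev < e - D.jump R j.rev := by
    intro i j hij
    have h1 := (D.jump R).strictMono (Fin.rev_lt_rev.2 hij)
    have h2 := (mem_jumps_symm H (jump_mem i.rev)).1
    omega
  have h : (fun i : Fin (D.flagLength R) => e - D.jump R i.rev) =
      (D.jumps_finite R).toFinset.orderEmbOfFin rfl := by
    refine Finset.orderEmbOfFin_unique rfl (fun i => ?_) (fun i j hij => ?_)
    · exact (D.jumps_finite R).mem_toFinset.2 (mem_jumps_symm H (jump_mem i.rev)).2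
    · exact aux i j hij
  exact (congrFun h i).symm

theorem flag_one (H : Ramified R s t δ e) :
    D.flag R 1 = radical (D.baseForm R) (D.baseForm_symm R) := by
  rw [flag_succ_eq H (c := 1) (k := 0) le_rfl (Nat.zero_le _) (fun j hj => absurd hj (by omega))
    (fun j _ => (jump_mem j).1)]
  ext x
  obtain ⟨v, rfl⟩ := toFibre_surjective x
  rw [mem_fullFlag H H.pos, mem_radical_iff H]

theorem flag_lt (H : Ramified R s t δ e) {i : ℕ} (hi : 1 ≤ i) (hi' : i ≤ D.flagLength R) :
    D.flag R (i + 1) < D.flag R i := by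
  obtain ⟨i, rfl⟩ := Nat.exists_eq_add_of_le' hi
  have hlt : i < D.flagLength R := hi'
  rw [flag_succ_eq H (c := D.jump R ⟨i, hlt⟩ + 1) (k := i + 1) (by omega) hi'
    (fun j hj => Nat.lt_succ_of_le ((D.jump R).monotone (Fin.le_def.2 (by simpa using by omega))))
    (fun j hj => (D.jump R).strictMono (Fin.lt_def.2 (by simpa using by omega))), flag, dif_pos hlt]
  exact lt_of_le_of_ne (D.fullFlag_antitone R (Nat.le_succ _)) (jump_mem ⟨i, hlt⟩).2

theorem flag_orthogonal (H : Ramified R s t δ e) {i j : ℕ} (hi : 1 ≤ i) (hj : 1 ≤ j)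
    (hij : i + j = D.flagLength R + 2) (x : radical (D.baseForm R) (D.baseForm_symm R)) :
    (x : Fibre R (D.invariants R)) ∈ D.flag R j ↔
      ∀ y : radical (D.baseForm R) (D.baseForm_symm R),
        (y : Fibre R (D.invariants R)) ∈ D.flag R i →
          radicalForm (D.baseForm R) (D.baseForm_symm R) x y = 0 := by
  obtain ⟨i, rfl⟩ := Nat.exists_eq_add_of_le' hi
  obtain ⟨j, rfl⟩ := Nat.exists_eq_add_of_le' hj
  by_cases hlt : i < D.flagLength R
  · obtain ⟨h1, h2⟩ := mem_jumps_symm H (jump_mem ⟨i, hlt⟩)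
    have h3 := (jump_mem ⟨i, hlt⟩).1
    have hF : D.flag R (i + 1) = D.fullFlag R (D.jump R ⟨i, hlt⟩) := by rw [flag, dif_pos hlt]
    rw [hF, ← mem_fullFlag_orthogonal H h3 h1.le,
      flag_succ_eq H (c := e + 1 - D.jump R ⟨i, hlt⟩) (k := j) (by omega) (by omega)]
    · intro k hk
      have h4 := jump_symm H k
      have h5 : D.jump R ⟨i, hlt⟩ ≤ D.jump R k.rev :=
        (D.jump R).monotone (Fin.le_def.2 (by rw [Fin.val_rev]; simpa using by omega))
      have h6 := (mem_jumps_symm H (jump_mem k.rev)).1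
      omega
    · intro k hk
      have h4 := jump_symm H k
      have h5 : D.jump R k.rev < D.jump R ⟨i, hlt⟩ :=
        (D.jump R).strictMono (Fin.lt_def.2 (by rw [Fin.val_rev]; simpa using by omega))
      omega
  · obtain rfl : j = 0 := by omega
    rw [zero_add, flag_one H, flag, dif_neg hlt]
    refine ⟨fun _ y hy => ?_, fun _ => x.2⟩
    rw [show y = 0 from Subtype.ext ((Submodule.mem_bot R).1 hy), map_zero]

theorem radicalForm_nondegenerate (H : Ramified R s t δ e)
    (x : radical (D.baseForm R) (D.baseForm_symm R))
    (hx : ∀ y, radicalForm (D.baseForm R) (D.baseForm_symm R) x y = 0) : x = 0 := by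
  have h := (mem_fullFlag_orthogonal H le_rfl H.pos x).2 (fun y _ => hx y)
  rw [Nat.add_sub_cancel, fullFlag_eq_bot H le_rfl] at h
  exact Subtype.ext ((Submodule.mem_bot R).1 h)

/-- `V` is a finite `R`-module. -/
instance [Module.Finite R S] : Module.Finite R (D.invariants R) := by
  have : Module.Finite R W := Module.Finite.trans S W
  infer_instance

/-- `V` is a free `R`-module. -/
instance [Module.Finite R S] : Module.Free R (D.invariants R) := by
  have : Module.IsTorsionFree R W := torsionFree R S W
  infer_instance

theorem eq_pow_smul (H : Ramified R s t δ e) (k : ℕ) (y : D.invariants R)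
    (h : ∀ w, ∃ r, D.baseForm R y w = s ^ (k + 1) * r) : ∃ y', y = s ^ k • y' := by
  induction k generalizing y with
  | zero => exact ⟨y, by simp⟩
  | succ k ih =>
    have h1 : toFibre y ∈ radical (D.baseForm R) (D.baseForm_symm R) := by
      rw [toFibre_mem_radical]
      intro w
      obtain ⟨r, hr⟩ := h w
      exact H.mem_maximalIdeal.2 ⟨s ^ (k + 1) * r, by rw [hr]; ring⟩
    have h2 := radicalForm_nondegenerate H ⟨toFibre y, h1⟩ (by
      rintro ⟨z, hz⟩
      obtain ⟨w, rfl⟩ := toFibre_surjective z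
      rw [radicalForm_eq_zero_iff]
      obtain ⟨r, hr⟩ := h w
      exact H.mem_sq.2 ⟨s ^ k * r, by rw [hr]; ring⟩)
    obtain ⟨y1, rfl⟩ := (mem_smul_top H).1 (toFibre_eq_zero.1 (congrArg Subtype.val h2))
    obtain ⟨y', rfl⟩ := ih y1 (fun w => by
      obtain ⟨r, hr⟩ := h w
      refine ⟨r, mul_left_cancel₀ H.irr.ne_zero ?_⟩
      rw [LinearMap.map_smul₂, smul_eq_mul] at hr
      rw [hr]; ring)
    exact ⟨y', by rw [smul_smul, pow_succ']⟩

theorem baseForm_singular [Module.Finite R S] (H : Ramified R s t δ e) (a : R)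
    (ha : a ∈ maximalIdeal R) (f : D.invariants R →ₗ[R] R) :
    ∃ v, D.baseForm R v = a • f := by
  have hinj : Function.Injective (D.baseForm R) := by
    rw [injective_iff_map_eq_zero]
    intro y hy
    have h1 : y ∈ (⨅ k : ℕ, maximalIdeal R ^ k • ⊤ : Submodule R (D.invariants R)) := by
      rw [Submodule.mem_iInf]
      intro k
      obtain ⟨y', rfl⟩ := eq_pow_smul H k y (fun w => ⟨0, by rw [hy]; simp⟩)
      exact Submodule.smul_mem_smul (Ideal.pow_mem_pow (H.mem_maximalIdeal.2 ⟨1, by simp⟩) k)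
        trivial
    rwa [Ideal.iInf_pow_smul_eq_bot_of_isLocalRing _ (maximalIdeal.isMaximal R).ne_top] at h1
  obtain ⟨b, hb, v, hv⟩ : ∃ b : R, b ≠ 0 ∧ ∃ v, D.baseForm R v = b • f := by
    let P := LinearMap.range (D.baseForm R)
    have h0 : Module.finrank R ((D.invariants R →ₗ[R] R) ⧸ P) = 0 := by
      have h1 := Submodule.finrank_quotient_add_finrank P
      have h2 : Module.finrank R P = Module.finrank R (D.invariants R) :=
        LinearMap.finrank_range_of_inj hinj
      have h3 : Module.finrank R (D.invariants R →ₗ[R] R) = Module.finrank R (D.invariants R) := by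
        rw [Module.finrank_linearMap, Module.finrank_self, mul_one]
      omega
    obtain ⟨b, hb, h⟩ := Module.finrank_eq_zero_iff.1 h0 (Submodule.Quotient.mk f)
    rw [← Submodule.Quotient.mk_smul, Submodule.Quotient.mk_eq_zero] at h
    obtain ⟨v, hv⟩ := h
    exact ⟨b, hb, v, hv⟩
  obtain ⟨N, u, hu⟩ := IsDiscreteValuationRing.eq_unit_mul_pow_irreducible hb H.irr
  have hv' : D.baseForm R (s • (↑u⁻¹ : R) • v) = s ^ (N + 1) • f := by
    rw [map_smul, map_smul, hv, hu, smul_smul, smul_smul]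
    congr 1
    rw [← mul_assoc, mul_assoc s, Units.inv_mul, mul_one, pow_succ']
  obtain ⟨y, hy⟩ := eq_pow_smul H N _ (fun w => ⟨f w, by rw [hv']; rfl⟩)
  rw [hy, map_smul, pow_succ, mul_smul] at hv'
  have hsf : D.baseForm R y = s • f := by
    ext w
    have := LinearMap.congr_fun hv' w
    simp only [LinearMap.smul_apply, smul_eq_mul] at this
    simpa using mul_left_cancel₀ (pow_ne_zero N H.irr.ne_zero) this
  obtain ⟨a', rfl⟩ := H.mem_maximalIdeal.1 ha
  exact ⟨a' • y, by rw [map_smul, hsf, smul_smul, mul_comm]⟩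

variable (R D)

/-- The germ at `x` of the degenerate orthogonal bundle with flags `(V, q, F)` associated with the
equivariant orthogonal bundle `(W, q')`: `V = W^Γ`, the form is the restriction of the form of `W`,
and the flag is the reduced flag of the fibre defined by the order of vanishing at `y`. -/
def degenerate [Module.Finite R S] : DegenerateOrthogonal R (D.invariants R) where
  form := D.baseForm R
  symm := D.baseForm_symm R
  singular := by
    obtain ⟨s, t, δ, e, H⟩ := exists_ramified R (Γ := Γ) (S := S) ‹_›
    exact baseForm_singular H
  length := D.flagLength R
  flag := D.flag R
  flag_zero := rfl
  flag_one := by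
    obtain ⟨s, t, δ, e, H⟩ := exists_ramified R (Γ := Γ) (S := S) ‹_›
    exact flag_one H
  flag_lt := by
    obtain ⟨s, t, δ, e, H⟩ := exists_ramified R (Γ := Γ) (S := S) ‹_›
    exact fun i => flag_lt H
  flag_bot := fun i hi => by
    obtain ⟨i, rfl⟩ := Nat.exists_eq_add_of_le' (Nat.one_le_of_lt hi)
    rw [flag, dif_neg (by omega)]
  nondegenerate := by
    obtain ⟨s, t, δ, e, H⟩ := exists_ramified R (Γ := Γ) (S := S) ‹_›
    exact radicalForm_nondegenerate H
  orthogonal := by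
    obtain ⟨s, t, δ, e, H⟩ := exists_ramified R (Γ := Γ) (S := S) ‹_›
    exact fun i j => flag_orthogonal H

end

end GammaOrthogonal

end

end OrthogonalGerm

open IsLocalRing

/-! Averaging over the finite group `Γ`, which characteristic zero allows, yields a uniformizer `p`
of `S` on which `Γ` acts by a character `χ : Γ →* ℂ` (`exists_eigen_uniformizer`). This `χ` is
injective: an element in its kernel fixes `p` and the constants, hence acts trivially modulo every
power of `p`. Since `χ` is faithful, its powers decompose `W`: every vector is a finite sum of
eigenvectors `u` with character `χ ^ k`, and a bounded power `p ^ c` makes each `u` invariant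
(`exists_sum_eigenvectors`). So `p ^ M W` lies in the `S`-span of `V = W ^ Γ` for one fixed `M`.
This gives the equality of ranks and the injectivity of restriction.

For surjectivity, let `g` be an automorphism of `V` that preserves the form and the flag. The flag
remembers all the subspaces `F_y ^ c`, and `V ∩ m_y ^ e W = m_x V`, where `e` is the ramification
index, so `g` preserves every `V ∩ m_y ^ c W` (`mem_sections_of_preservesFlag`). Extend `g` linearly
to the span of `V`. On an eigenvector `u` the extension should be `g (p ^ c u) / p ^ c`, and this
lies in `W` because `p ^ c u` is in `V ∩ m_y ^ c W`, hence so is its image (`exists_extension`).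
Compatibility with the form and with `Γ` is checked on `V`, which spans `W` up to `p ^ M`.

Conversely, an equivariant `S`-linear isometry preserves the order of vanishing, hence the flag. The
conditions on the graded pieces then follow from those on the form and the flag
(`isAut_of_form_of_flag`). The pairings are perfect because the orthogonality relations of the flag
make them separating, between finite-dimensional spaces and with values in a line. -/

namespace OrthogonalGerm

noncomputable section


/-! ### Separating pairings with values in a line. -/

section Perfect

variable {R : Type*} [CommRing R] [IsLocalRing R]

/-- A bilinear map between vector spaces of finite dimension, with values in a line and with
trivial kernels on both sides, is perfect. -/
theorem bijective_of_separating_field {k M N C : Type*} [Field k] [AddCommGroup M] [Module k M]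
    [AddCommGroup N] [Module k N] [AddCommGroup C] [Module k C] [Module.Finite k M]
    [Module.Finite k N] (hC : Module.finrank k C = 1) (B : M →ₗ[k] N →ₗ[k] C)
    (h : ∀ x, (∀ y, B x y = 0) → x = 0) (h' : ∀ y, (∀ x, B x y = 0) → y = 0) :
    Function.Bijective B := by
  have : Module.Finite k C := Module.finite_of_finrank_pos (by omega)
  have hB : Function.Injective B := (injective_iff_map_eq_zero B).2 fun x hx =>
    h x fun y => by rw [hx, LinearMap.zero_apply]
  have hB' : Function.Injective B.flip := (injective_iff_map_eq_zero B.flip).2 fun y hy =>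
    h' y fun x => by rw [← LinearMap.flip_apply, hy, LinearMap.zero_apply]
  -- The two injections give `dim M ≤ dim N` and `dim N ≤ dim M`.
  have h1 := LinearMap.finrank_le_finrank_of_injective hB
  have h2 := LinearMap.finrank_le_finrank_of_injective hB'
  rw [Module.finrank_linearMap, hC, mul_one] at h1 h2
  have h3 : Module.finrank k M = Module.finrank k (N →ₗ[k] C) := by
    rw [Module.finrank_linearMap, hC, mul_one, le_antisymm h1 h2]
  exact ⟨hB, (LinearMap.injective_iff_surjective_of_finrank_eq_finrank h3).1 hB⟩

/-- The version of `bijective_of_separating_field` for modules over a local ring that are killed by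
the maximal ideal. -/
theorem bijective_of_separating {M N C : Type*} [AddCommGroup M] [Module R M] [AddCommGroup N]
    [Module R N] [AddCommGroup C] [Module R C] [Module (ResidueField R) C]
    [IsScalarTower R (ResidueField R) C] [Module.Finite R M] [Module.Finite R N]
    (hM : ∀ r ∈ maximalIdeal R, ∀ x : M, r • x = 0)
    (hN : ∀ r ∈ maximalIdeal R, ∀ y : N, r • y = 0)
    (hC : Module.finrank (ResidueField R) C = 1) (B : M →ₗ[R] N →ₗ[R] C)
    (h : ∀ x, (∀ y, B x y = 0) → x = 0) (h' : ∀ y, (∀ x, B x y = 0) → y = 0) :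
    Function.Bijective B := by
  have tM : Module.IsTorsionBySet R M (maximalIdeal R) := fun x r => hM r r.2 x
  have tN : Module.IsTorsionBySet R N (maximalIdeal R) := fun x r => hN r r.2 x
  let _ : Module (ResidueField R) M := tM.module
  let _ : Module (ResidueField R) N := tN.module
  have : IsScalarTower R (ResidueField R) M := tM.isScalarTower
  have : IsScalarTower R (ResidueField R) N := tN.isScalarTower
  have : Module.Finite (ResidueField R) M := Module.Finite.of_restrictScalars_finite R _ _
  have : Module.Finite (ResidueField R) N := Module.Finite.of_restrictScalars_finite R _ _
  have hs : Function.Surjective (algebraMap R (ResidueField R)) := residue_surjective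
  -- As `R` surjects onto its residue field, `R`-linear maps between these modules are automatically
  -- linear over the residue field.
  let B' : M →ₗ[ResidueField R] N →ₗ[ResidueField R] C :=
    { toFun := fun x => (B x).extendScalarsOfSurjective hs
      map_add' := fun x x' => by ext; simp
      map_smul' := fun a x => by
        obtain ⟨r, rfl⟩ := hs a
        have h1 : residue R r • x = r • x := algebraMap_smul (ResidueField R) r x
        ext y
        have h2 : residue R r • B x y = r • B x y := algebraMap_smul (ResidueField R) r (B x y)
        simp [h1, h2] }
  have hB' : Function.Bijective B' := bijective_of_separating_field hC B' h h'
  refine ⟨fun x x' hx => hB'.1 (LinearMap.ext fun y => LinearMap.congr_fun hx y), fun f => ?_⟩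
  obtain ⟨x, hx⟩ := hB'.2 (f.extendScalarsOfSurjective hs)
  exact ⟨x, LinearMap.ext fun y => LinearMap.congr_fun hx y⟩

theorem smul_fibre_eq_zero {V : Type*} [AddCommGroup V] [Module R V] {r : R}
    (hr : r ∈ maximalIdeal R) (x : Fibre R V) : r • x = 0 := by
  obtain ⟨v, rfl⟩ := toFibre_surjective x
  rw [← map_smul, toFibre_eq_zero]
  exact Submodule.smul_mem_smul hr trivial

end Perfect

/-! ### Perfectness and invariance of the pairings on the graded pieces. -/

namespace DegenerateOrthogonal

variable {R V : Type*} [CommRing R] [IsDomain R] [IsDiscreteValuationRing R] [AddCommGroup V]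
  [Module R V] [Module.Free R V] [Module.Finite R V] (E : DegenerateOrthogonal R V)

theorem smul_graded_eq_zero {i : ℕ} {r : R} (hr : r ∈ maximalIdeal R) (x : E.Graded i) :
    r • x = 0 := by
  obtain ⟨y, rfl⟩ := E.toGraded_surjective i x
  have : r • y = 0 := Subtype.ext (smul_fibre_eq_zero hr (y : Fibre R V))
  rw [← map_smul, this, map_zero]

theorem pairing_toGraded {i j : ℕ} (hi : 1 ≤ i) (hj : 1 ≤ j) (hij : i + j = E.length + 1)
    (x : E.flag i) (y : E.flag j) :
    E.pairing i j hi hj hij (E.toGraded i x) (E.toGraded j y) =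
      radicalForm E.form E.symm (Submodule.inclusion (E.flag_le_radical hi) x)
        (Submodule.inclusion (E.flag_le_radical hj) y) :=
  descendBilin_apply _ _ _ _ _ _ _ _ _

theorem zeroForm_toGraded (x y : E.flag 0) :
    E.zeroForm (E.toGraded 0 x) (E.toGraded 0 y) = fibreForm E.form E.symm x y :=
  descendBilin_apply _ _ _ _ _ _ _ _ _

theorem pairing_symm {i j : ℕ} (hi : 1 ≤ i) (hj : 1 ≤ j) (hij : i + j = E.length + 1)
    (hji : j + i = E.length + 1) (x : E.Graded i) (y : E.Graded j) :
    E.pairing i j hi hj hij x y = E.pairing j i hj hi hji y x := by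
  obtain ⟨x, rfl⟩ := E.toGraded_surjective i x
  obtain ⟨y, rfl⟩ := E.toGraded_surjective j y
  rw [pairing_toGraded, pairing_toGraded, radicalForm_symm]

/-- A representative in `F^i` orthogonal to `F^j` lies in the complement of `F^j`, which is
`F^{i+1}` because `(i + 1) + j = m + 2`; so its class in `G^i` vanishes. -/
theorem pairing_separating {i j : ℕ} (hi : 1 ≤ i) (hj : 1 ≤ j) (hij : i + j = E.length + 1)
    (x : E.Graded i) (h : ∀ y, E.pairing i j hi hj hij x y = 0) : x = 0 := by
  obtain ⟨x, rfl⟩ := E.toGraded_surjective i x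
  rw [toGraded_eq_zero]
  refine (E.orthogonal j (i + 1) hj (by omega) (by omega)
    (Submodule.inclusion (E.flag_le_radical hi) x)).2 fun y hy => ?_
  have := h (E.toGraded j ⟨y, hy⟩)
  rwa [pairing_toGraded] at this

theorem pairing_bijective {i j : ℕ} (hi : 1 ≤ i) (hj : 1 ≤ j) (hij : i + j = E.length + 1) :
    Function.Bijective (E.pairing i j hi hj hij) :=
  -- Reading `m_x / m_x²` as `CotangentSpace R` provides its residue field structure; it is a line
  -- because `R` is a discrete valuation ring.
  bijective_of_separating (C := CotangentSpace R) (fun _ hr => E.smul_graded_eq_zero hr)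
    (fun _ hr => E.smul_graded_eq_zero hr) (finrank_CotangentSpace_eq_one R) _
    (E.pairing_separating hi hj hij) fun y hy =>
      E.pairing_separating hj hi (by omega) y fun x => by rw [← E.pairing_symm hi hj hij, hy]

theorem fibreForm_symm (x y : Fibre R V) :
    fibreForm E.form E.symm x y = fibreForm E.form E.symm y x := by
  obtain ⟨v, rfl⟩ := toFibre_surjective x
  obtain ⟨w, rfl⟩ := toFibre_surjective y
  rw [fibreForm_apply, fibreForm_apply, E.symm]

theorem zeroForm_symm (x y : E.Graded 0) : E.zeroForm x y = E.zeroForm y x := by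
  obtain ⟨x, rfl⟩ := E.toGraded_surjective 0 x
  obtain ⟨y, rfl⟩ := E.toGraded_surjective 0 y
  rw [zeroForm_toGraded, zeroForm_toGraded, fibreForm_symm]

/-- Passing to `G^0` divides the fibre exactly by the kernel of its form, since `F^1` is that
kernel. -/
theorem zeroForm_separating (x : E.Graded 0) (h : ∀ y, E.zeroForm x y = 0) : x = 0 := by
  obtain ⟨x, rfl⟩ := E.toGraded_surjective 0 x
  rw [toGraded_eq_zero, E.flag_one, radical, LinearMap.mem_ker]
  refine LinearMap.ext fun y => ?_
  have := h (E.toGraded 0 ⟨y, by rw [E.flag_zero]; trivial⟩)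
  rwa [zeroForm_toGraded] at this

theorem zeroForm_bijective : Function.Bijective E.zeroForm :=
  bijective_of_separating (fun _ hr => E.smul_graded_eq_zero hr)
    (fun _ hr => E.smul_graded_eq_zero hr) (Module.finrank_self _) _ E.zeroForm_separating
    fun y hy => E.zeroForm_separating y fun x => by rw [zeroForm_symm, hy]

theorem fibreForm_fibreMap {g : V ≃ₗ[R] V} (hg : ∀ v w, E.form (g v) (g w) = E.form v w)
    (x y : Fibre R V) :
    fibreForm E.form E.symm (fibreMap (g : V →ₗ[R] V) x) (fibreMap (g : V →ₗ[R] V) y) =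
      fibreForm E.form E.symm x y := by
  obtain ⟨v, rfl⟩ := toFibre_surjective x
  obtain ⟨w, rfl⟩ := toFibre_surjective y
  simp [fibreForm_apply, hg]

/-- On representatives both sides are the class of the same element of `m_x`. The images are
separate variables `x'`, `y'`, so that no induced map on the kernel has to be constructed. -/
theorem radicalForm_fibreMap {g : V ≃ₗ[R] V} (hg : ∀ v w, E.form (g v) (g w) = E.form v w)
    (x y x' y' : radical E.form E.symm)
    (hx : (x' : Fibre R V) = fibreMap (g : V →ₗ[R] V) x)
    (hy : (y' : Fibre R V) = fibreMap (g : V →ₗ[R] V) y) :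
    radicalForm E.form E.symm x' y' = radicalForm E.form E.symm x y := by
  obtain ⟨v, rfl⟩ := toRadical_surjective _ _ x
  obtain ⟨w, rfl⟩ := toRadical_surjective _ _ y
  have hv : g v ∈ radicalSections E.form E.symm := by
    change toFibre (g v) ∈ radical E.form E.symm
    exact hx ▸ x'.2
  have hw : g w ∈ radicalSections E.form E.symm := by
    change toFibre (g w) ∈ radical E.form E.symm
    exact hy ▸ y'.2
  obtain rfl : x' = toRadical _ _ ⟨g v, hv⟩ := Subtype.ext hx
  obtain rfl : y' = toRadical _ _ ⟨g w, hw⟩ := Subtype.ext hy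
  rw [radicalForm_apply, radicalForm_apply]
  congr 1
  exact Subtype.ext (hg _ _)

variable {E} in
/-- An automorphism that preserves the form and the flag preserves the induced pairings. -/
theorem isAut_of_form_of_flag {g : V ≃ₗ[R] V} (hg : ∀ v w, E.form (g v) (g w) = E.form v w)
    (hF : E.PreservesFlag g) : E.IsAut g := by
  have hp : ∀ i j hi hj hij x y,
      E.pairing i j hi hj hij (hF.graded i x) (hF.graded j y) = E.pairing i j hi hj hij x y := by
    intro i j hi hj hij x y
    obtain ⟨x, rfl⟩ := E.toGraded_surjective i x
    obtain ⟨y, rfl⟩ := E.toGraded_surjective j y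
    have h1 : ∀ k (z : E.flag k), hF.graded k (E.toGraded k z) =
      E.toGraded k ⟨fibreMap (g : V →ₗ[R] V) z, hF.mem k z.2⟩ := fun _ _ => rfl
    rw [h1, h1, pairing_toGraded, pairing_toGraded]
    exact E.radicalForm_fibreMap hg _ _ _ _ rfl rfl
  refine ⟨hg, hF, hp, fun x => ?_, fun i hi him x => hp i i hi hi him x x⟩
  obtain ⟨x, rfl⟩ := E.toGraded_surjective 0 x
  change E.zeroForm (E.toGraded 0 ⟨fibreMap (g : V →ₗ[R] V) x, hF.mem 0 x.2⟩)
    (E.toGraded 0 ⟨fibreMap (g : V →ₗ[R] V) x, hF.mem 0 x.2⟩) =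
    E.zeroForm (E.toGraded 0 x) (E.toGraded 0 x)
  rw [zeroForm_toGraded, zeroForm_toGraded]
  exact E.fibreForm_fibreMap hg _ _

end DegenerateOrthogonal


namespace GammaOrthogonal

/-! ### A uniformizer that is an eigenvector of the isotropy group. -/

section Eigen

variable (Γ R S : Type*) [Group Γ] [Finite Γ] [CommRing R] [CommRing S] [IsDomain S]
  [IsDiscreteValuationRing S] [Algebra ℂ R] [Algebra ℂ S] [Algebra R S] [IsScalarTower ℂ R S]
  [MulSemiringAction Γ S] [IsGaloisGroup Γ R S]

include R in
theorem smul_algebraMap_complex (γ : Γ) (z : ℂ) : γ • algebraMap ℂ S z = algebraMap ℂ S z := by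
  have : SMulCommClass Γ R S := IsGaloisGroup.commutes
  rw [IsScalarTower.algebraMap_apply ℂ R S, smul_algebraMap]

variable {Γ R S}

theorem exists_sub_mem (hS : Function.Bijective (algebraMap ℂ (ResidueField S))) (a : S) :
    ∃ z : ℂ, a - algebraMap ℂ S z ∈ maximalIdeal S := by
  obtain ⟨z, hz⟩ := hS.2 (residue S a)
  refine ⟨z, ?_⟩
  rw [← residue_eq_zero_iff, map_sub, ← hz, sub_eq_zero]
  rfl

theorem smul_dvd {t : S} (ht : Irreducible t) (γ : Γ) {a : S} {k : ℕ} (ha : t ^ k ∣ a) :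
    t ^ k ∣ γ • a := by
  have h : t ∣ γ • t := by
    rw [← Ideal.mem_span_singleton, ← ht.maximalIdeal_eq, mem_maximalIdeal, mem_nonunits_iff]
    intro hu
    apply ht.not_isUnit
    simpa using hu.map (MulSemiringAction.toRingHom Γ S γ⁻¹)
  obtain ⟨b, rfl⟩ := ha
  rw [smul_mul', smul_pow']
  exact (pow_dvd_pow_of_dvd h k).mul_right _

/-- A non-zero constant is a unit, so it cannot be divisible by `t`. This makes the scalar by which
`γ` acts on the cotangent line unique, whence its multiplicativity. -/
theorem eq_of_sq_dvd {t : S} (ht : Irreducible t) {z z' : ℂ}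
    (h : t ^ 2 ∣ algebraMap ℂ S z * t - algebraMap ℂ S z' * t) : z = z' := by
  by_contra hne
  rw [← sub_mul, ← map_sub, pow_two, mul_dvd_mul_iff_right ht.ne_zero] at h
  exact ht.not_isUnit (isUnit_of_dvd_unit h
    ((isUnit_iff_ne_zero.2 (sub_ne_zero.2 hne)).map (algebraMap ℂ S)))

include R in
/-- The action of the isotropy group on the cotangent line. -/
theorem exists_cotangent_character (hS : Function.Bijective (algebraMap ℂ (ResidueField S)))
    {t : S} (ht : Irreducible t) :
    ∃ χ : Γ →* ℂ, ∀ γ : Γ, t ^ 2 ∣ γ • t - algebraMap ℂ S (χ γ) * t := by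
  have h : ∀ γ : Γ, ∃ z : ℂ, t ^ 2 ∣ γ • t - algebraMap ℂ S z * t := fun γ => by
    obtain ⟨u, hu⟩ : t ∣ γ • t := by simpa using smul_dvd ht γ (k := 1) (a := t) (by simp)
    obtain ⟨z, hz⟩ := exists_sub_mem hS u
    rw [ht.maximalIdeal_eq, Ideal.mem_span_singleton] at hz
    refine ⟨z, ?_⟩
    rw [hu, mul_comm t, ← sub_mul, pow_two]
    exact mul_dvd_mul_right hz t
  choose χ hχ using h
  refine ⟨{ toFun := χ, map_one' := ?_, map_mul' := fun γ η => ?_ }, hχ⟩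
  · apply eq_of_sq_dvd ht
    have := hχ 1
    rw [one_smul] at this
    rw [map_one, one_mul]
    exact (dvd_sub_comm).1 this
  · apply eq_of_sq_dvd ht
    have h1 := hχ (γ * η)
    have h2 := smul_dvd ht γ (hχ η)
    rw [smul_sub, smul_mul', smul_algebraMap_complex Γ R S, ← mul_smul] at h2
    -- Constants are fixed by `γ`, so modulo `t ^ 2` the element `γ • η • t` is `χ η * γ • t`, that
    -- is, `χ γ * χ η * t`.
    have h3 := (hχ γ).mul_left (algebraMap ℂ S (χ η))
    rw [map_mul]
    convert (h2.add h3).sub h1 using 1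
    ring

theorem eq_zero_of_forall_dvd {t : S} (ht : Irreducible t) {a : S} (h : ∀ k, t ^ k ∣ a) :
    a = 0 := by
  have h1 : a ∈ (⨅ k : ℕ, maximalIdeal S ^ k) := by
    rw [Ideal.mem_iInf]
    intro k
    rw [ht.maximalIdeal_eq, Ideal.span_singleton_pow, Ideal.mem_span_singleton]
    exact h k
  rwa [Ideal.iInf_pow_eq_bot_of_isLocalRing _ (maximalIdeal.isMaximal S).ne_top] at h1

include R in
/-- There is a uniformizer on which the isotropy group acts by a faithful character. -/
theorem exists_eigen_uniformizer (hS : Function.Bijective (algebraMap ℂ (ResidueField S))) :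
    ∃ (p : S) (χ : Γ →* ℂ), Irreducible p ∧ Function.Injective χ ∧
      ∀ γ : Γ, γ • p = algebraMap ℂ S (χ γ) * p := by
  classical
  have := Fintype.ofFinite Γ
  obtain ⟨t, ht⟩ := IsDiscreteValuationRing.exists_irreducible S
  obtain ⟨χ, hχ⟩ := exists_cotangent_character (Γ := Γ) (R := R) hS ht
  have hinv : ∀ γ : Γ, χ γ⁻¹ * χ γ = 1 := fun γ => by rw [← map_mul, inv_mul_cancel, map_one]
  have hc : (Fintype.card Γ : ℂ) ≠ 0 := by simp
  -- This is `|Γ|` times the projection of `t` to the `χ`-eigenspace. Modulo `t ^ 2` each summand is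
  -- `t`, so `p` is `|Γ| * t` to first order and remains a uniformizer.
  let p : S := ∑ γ : Γ, algebraMap ℂ S (χ γ⁻¹) * γ • t
  have hp : ∀ γ : Γ, γ • p = algebraMap ℂ S (χ γ) * p := fun γ => by
    simp only [p, Finset.smul_sum, Finset.mul_sum]
    refine Fintype.sum_equiv (Equiv.mulLeft γ) _ _ fun η => ?_
    rw [Equiv.coe_mulLeft, smul_mul', smul_algebraMap_complex Γ R S, mul_inv_rev, map_mul, mul_smul,
      ← mul_assoc, ← map_mul]
    congr 2
    rw [mul_comm, mul_assoc, hinv, mul_one]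
  have hpt : t ^ 2 ∣ p - (Fintype.card Γ : S) * t := by
    have : p - (Fintype.card Γ : S) * t =
        ∑ γ : Γ, algebraMap ℂ S (χ γ⁻¹) * (γ • t - algebraMap ℂ S (χ γ) * t) := by
      simp only [p, mul_sub, Finset.sum_sub_distrib, ← mul_assoc, ← map_mul, hinv, map_one, one_mul]
      rw [Finset.sum_const, Finset.card_univ, nsmul_eq_mul]
    rw [this]
    exact Finset.dvd_sum fun γ _ => (hχ γ).mul_left _
  have hirr : Irreducible p := by
    obtain ⟨b, hb⟩ := hpt
    have hp' : p = t * ((Fintype.card Γ : S) + t * b) := by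
      rw [sub_eq_iff_eq_add] at hb
      rw [hb]; ring
    have hcu : IsUnit (Fintype.card Γ : S) := by
      rw [← map_natCast (algebraMap ℂ S)]
      exact (isUnit_iff_ne_zero.2 hc).map _
    have hu : IsUnit ((Fintype.card Γ : S) + t * b) := by
      by_contra hcon
      have h1 : (Fintype.card Γ : S) + t * b ∈ maximalIdeal S := hcon
      have h2 : t * b ∈ maximalIdeal S := by
        rw [ht.maximalIdeal_eq, Ideal.mem_span_singleton]
        exact dvd_mul_right t b
      exact (mem_maximalIdeal _).1 ((Ideal.add_mem_iff_left _ h2).1 h1) hcu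
    rw [hp']
    exact (irreducible_mul_isUnit hu).2 ht
  refine ⟨p, χ, hirr, (injective_iff_map_eq_one χ).2 fun γ hγ => ?_, hp⟩
  -- If `χ γ = 1`, then `γ` fixes `p` and the constants. Writing `a = z + p * b` with `z` constant,
  -- each induction step gains a factor `p`.
  have hdvd : ∀ (k : ℕ) (a : S), p ^ k ∣ γ • a - a := by
    intro k
    induction k with
    | zero => simp
    | succ k ih =>
      intro a
      obtain ⟨z, hz⟩ := exists_sub_mem hS a
      rw [hirr.maximalIdeal_eq, Ideal.mem_span_singleton] at hz
      obtain ⟨b, hb⟩ := hz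
      rw [sub_eq_iff_eq_add] at hb
      have : γ • a - a = p * (γ • b - b) := by
        rw [hb, smul_add, smul_mul', hp, hγ, smul_algebraMap_complex Γ R S, map_one]
        ring
      rw [this, pow_succ']
      exact mul_dvd_mul_left p (ih b)
  have : FaithfulSMul Γ S := IsGaloisGroup.faithful R
  refine eq_of_smul_eq_smul (α := S) fun a => ?_
  rw [one_smul]
  exact sub_eq_zero.1 (eq_zero_of_forall_dvd hirr fun k => hdvd k a)

end Eigen

end GammaOrthogonal


namespace GammaOrthogonal

/-! ### Eigenvector decomposition: the invariants span up to a power of the uniformizer. -/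

section Spanning

variable {Γ R S W : Type*} [Group Γ] [CommRing R] [CommRing S] [Algebra R S]
  [MulSemiringAction Γ S] [IsGaloisGroup Γ R S] [AddCommGroup W] [Module S W] [Module R W]
  [IsScalarTower R S W] [DistribMulAction Γ W] (D : GammaOrthogonal Γ S W)

theorem smul_mem_span_invariants {p : S} {M : ℕ}
    (h : ∀ w : W, w ∈ AddSubmonoid.closure {u : W | ∃ c ≤ M, p ^ c • u ∈ D.invariants R})
    (w : W) : p ^ M • w ∈ Submodule.span S (D.invariants R : Set W) := by
  induction h w using AddSubmonoid.closure_induction with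
  | mem u hu =>
    obtain ⟨c, hc, hu⟩ := hu
    obtain ⟨d, rfl⟩ := Nat.exists_eq_add_of_le' hc
    rw [pow_add, mul_smul]
    exact Submodule.smul_mem _ _ (Submodule.subset_span hu)
  | zero => rw [smul_zero]; exact zero_mem _
  | add a b _ _ ha hb => rw [smul_add]; exact add_mem ha hb

variable [Finite Γ] [Algebra ℂ R] [Algebra ℂ S] [IsScalarTower ℂ R S]

/-- Every vector is a sum of eigenvectors `u` of the isotropy group, for each of which a power of
the eigen-uniformizer makes `u` invariant. -/
theorem exists_sum_eigenvectors {p : S} {χ : Γ →* ℂ} (hχ : Function.Injective χ)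
    (hp : ∀ γ : Γ, γ • p = algebraMap ℂ S (χ γ) * p) :
    ∃ M : ℕ, ∀ w : W, w ∈ AddSubmonoid.closure
      {u : W | ∃ c ≤ M, p ^ c • u ∈ D.invariants R} := by
  classical
  have := Fintype.ofFinite Γ
  set N := Fintype.card Γ with hN
  have hN0 : (N : ℂ) ≠ 0 := by simp [hN]
  have hχN : ∀ γ : Γ, χ γ ^ N = 1 := fun γ => by rw [← map_pow, pow_card_eq_one, map_one]
  have hinv : ∀ γ : Γ, χ γ⁻¹ * χ γ = 1 := fun γ => by rw [← map_mul, inv_mul_cancel, map_one]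
  -- An eigenvector of character `χ ^ k` becomes invariant after multiplication by `p ^ ((N - 1) *
  -- k)`, since `χ ^ (N * k) = 1`. As `k < N`, the bound `(N - 1) * N` serves for all `k`; it is not
  -- meant to be sharp.
  refine ⟨(N - 1) * N, fun w => ?_⟩
  -- `N` times the projection of `w` to the `χ ^ k`-eigenspace.
  let P : ℕ → W := fun k => ∑ γ : Γ, algebraMap ℂ R (χ γ⁻¹ ^ k) • γ • w
  have hP : ∀ (k : ℕ) (γ : Γ), γ • P k = algebraMap ℂ R (χ γ ^ k) • P k := fun k γ => by
    simp only [P, Finset.smul_sum]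
    refine Fintype.sum_equiv (Equiv.mulLeft γ) _ _ fun η => ?_
    rw [Equiv.coe_mulLeft, D.smul_base_smul R, mul_inv_rev, map_mul, mul_smul,
      smul_smul (algebraMap ℂ R (χ γ ^ k)), ← map_mul]
    congr 2
    rw [mul_pow, mul_left_comm, ← mul_pow, mul_comm (χ γ), hinv, one_pow, mul_one]
  have hsum : ∑ k ∈ Finset.range N, P k = algebraMap ℂ R (N : ℂ) • w := by
    simp only [P]
    rw [Finset.sum_comm]
    simp only [← Finset.sum_smul, ← map_sum]
    -- For `γ ≠ 1`, faithfulness makes `χ γ⁻¹` an `N`-th root of unity other than `1`, so its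
    -- geometric sum vanishes. Only `γ = 1` contributes.
    rw [Finset.sum_eq_single 1]
    · simp
    · intro γ _ hγ
      have h1 : χ γ⁻¹ - 1 ≠ 0 := sub_ne_zero.2 fun h =>
        hγ (inv_eq_one.1 (hχ (h.trans (map_one χ).symm)))
      have h2 : ∑ k ∈ Finset.range N, χ γ⁻¹ ^ k = 0 := by
        have := geom_sum_mul (χ γ⁻¹) N
        rw [hχN, sub_self] at this
        exact (mul_eq_zero.1 this).resolve_right h1
      rw [h2, map_zero, zero_smul]
    · simp
  have hw : w = ∑ k ∈ Finset.range N, algebraMap ℂ R (N : ℂ)⁻¹ • P k := by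
    rw [← Finset.smul_sum, hsum, smul_smul, ← map_mul, inv_mul_cancel₀ hN0, map_one, one_smul]
  rw [hw]
  refine sum_mem fun k hk => AddSubmonoid.subset_closure ⟨(N - 1) * k, ?_, fun γ => ?_⟩
  · exact Nat.mul_le_mul_left _ (Finset.mem_range.1 hk).le
  · have hN1 : (N - 1) * k + k = N * k := by
      have : 1 ≤ N := Fintype.card_pos
      obtain ⟨n, hn⟩ := Nat.exists_eq_add_of_le' this
      rw [hn, Nat.add_sub_cancel]; ring
    rw [D.semilinear, D.smul_base_smul R, hP, smul_pow', hp, mul_pow, ← map_pow,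
      mul_comm _ (p ^ _), mul_smul]
    congr 1
    rw [IsScalarTower.algebraMap_apply ℂ R S, algebraMap_smul, smul_smul, ← map_mul, smul_smul,
      ← map_mul, mul_right_comm, ← pow_add, hN1, pow_mul, hχN, one_pow, one_mul]

end Spanning

/-! ### Rank of the invariants and linear extension from `V` to `W`. -/

section Extension

variable {Γ R S W : Type*} [Group Γ] [Finite Γ] [CommRing R] [IsDomain R]
  [IsDiscreteValuationRing R] [CommRing S] [IsDomain S] [IsDiscreteValuationRing S]
  [Algebra ℂ R] [Algebra R S] [FaithfulSMul R S]
  [MulSemiringAction Γ S] [IsGaloisGroup Γ R S] [AddCommGroup W] [Module S W] [Module.Free S W]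
  [Module.Finite S W] [Module R W]
  [IsScalarTower R S W] [DistribMulAction Γ W] (D : GammaOrthogonal Γ S W)

variable (R) in
/-- The `S`-span of the invariants is generically all of `W`, as witnessed by `a`. -/
def IsDenominator (a : S) : Prop :=
  a ≠ 0 ∧ ∀ w : W, a • w ∈ Submodule.span S (D.invariants R : Set W)

variable {D}

/-- Two linear maps that agree on the invariants are equal. -/
theorem IsDenominator.ext {a : S} (ha : IsDenominator R D a) {U : Type*} [AddCommGroup U]
    [Module S U] [Module.IsTorsionFree S U] {f g : W →ₗ[S] U}
    (h : ∀ v : D.invariants R, f v = g v) : f = g := by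
  ext w
  apply smul_right_injective U ha.1
  change a • f w = a • g w
  rw [← map_smul, ← map_smul]
  exact LinearMap.eqOn_span (f := f) (g := g) (fun v hv => h ⟨v, hv⟩) (ha.2 w)

/-- The functional `D.form v` vanishes on the invariants, hence on `W`, and the form on `W` is
non-degenerate. -/
theorem baseForm_separating {a : S} (ha : IsDenominator R D a) (v : D.invariants R)
    (hv : ∀ w, D.baseForm R v w = 0) : v = 0 := by
  refine Subtype.ext (D.nondegenerate.1 ?_)
  rw [Submodule.coe_zero, map_zero]
  refine ha.ext fun w => ?_
  rw [← D.algebraMap_baseForm R, hv, map_zero, LinearMap.zero_apply]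

/-- A basis of the invariants remains independent over `S`. -/
theorem linearIndependent_invariants {a : S} (ha : IsDenominator R D a) {ι : Type*} [Finite ι]
    (b : Module.Basis ι R (D.invariants R)) : LinearIndependent S fun i => (b i : W) := by
  classical
  have := Fintype.ofFinite ι
  rw [Fintype.linearIndependent_iff]
  intro c hc
  have hB : (D.baseForm R).Nondegenerate :=
    ⟨fun v hv => baseForm_separating ha v hv,
      fun v hv => baseForm_separating ha v fun w => by rw [baseForm_symm, hv]⟩
  -- The Gram determinant of the basis is non-zero in `R`, hence in `S`. Pairing a relation over `S`
  -- with each `b j` puts its coefficients in the kernel of the Gram matrix.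
  have hdet : ((LinearMap.toMatrix₂ b b (D.baseForm R)).map (algebraMap R S)).det ≠ 0 := by
    rw [← RingHom.mapMatrix_apply, ← RingHom.map_det]
    intro h
    have h0 := FaithfulSMul.algebraMap_injective R S (h.trans (map_zero _).symm)
    exact (LinearMap.nondegenerate_iff_det_ne_zero b).1 hB h0
  have := Matrix.eq_zero_of_vecMul_eq_zero hdet (v := c) (by
    funext j
    have h1 := congrArg (fun w => D.form w (b j)) hc
    simpa [Matrix.vecMul, dotProduct, LinearMap.toMatrix₂_apply, algebraMap_baseForm] using h1)
  exact fun i => congrFun this i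

variable [Module.Finite R S]

variable (R D) in
-- One inequality is the independence over `S` of a basis of `V`. For the other, multiplication by
-- `a` embeds `W` in the span of that basis.
theorem finrank_invariants {a : S} (ha : IsDenominator R D a) :
    Module.finrank R (D.invariants R) = Module.finrank S W := by
  let b := Module.Free.chooseBasis R (D.invariants R)
  have hb := linearIndependent_invariants ha b
  apply le_antisymm
  · rw [Module.finrank_eq_card_basis b]
    exact hb.fintype_card_le_finrank
  · have hspan : Submodule.span S (D.invariants R : Set W) ≤
        Submodule.span S (Set.range fun i => (b i : W)) := by
      rw [Submodule.span_le]
      intro v hv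
      have := congrArg Subtype.val (b.sum_repr ⟨v, hv⟩)
      simp only [AddSubmonoidClass.coe_finsetSum, Submodule.coe_smul] at this
      rw [← this]
      refine sum_mem fun i _ => ?_
      rw [← algebraMap_smul S]
      exact Submodule.smul_mem _ _ (Submodule.subset_span ⟨i, rfl⟩)
    let f : W →ₗ[S] Submodule.span S (Set.range fun i => (b i : W)) :=
      (a • LinearMap.id).codRestrict _ fun w => hspan (ha.2 w)
    have hf : Function.Injective f := fun w w' h =>
      smul_right_injective W ha.1 (congrArg Subtype.val h)
    rw [Module.finrank_eq_card_basis b, ← finrank_span_eq_card hb]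
    exact LinearMap.finrank_le_finrank_of_injective hf

/-- An `R`-basis of `V` is an `S`-basis of the span of `V`, so the extension may be prescribed on
it. -/
theorem exists_extension_span {a : S} (ha : IsDenominator R D a)
    (g : D.invariants R →ₗ[R] D.invariants R) :
    ∃ G : Submodule.span S (D.invariants R : Set W) →ₗ[S] W,
      ∀ v : D.invariants R, G ⟨v, Submodule.subset_span v.2⟩ = g v := by
  let b := Module.Free.chooseBasis R (D.invariants R)
  have hb := linearIndependent_invariants ha b
  have hmem : ∀ v : D.invariants R,
      (v : W) = ∑ i, algebraMap R S (b.repr v i) • (b i : W) := fun v => by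
    conv_lhs => rw [← b.sum_repr v]
    simp only [AddSubmonoidClass.coe_finsetSum, Submodule.coe_smul, algebraMap_smul]
  have hspan : Submodule.span S (D.invariants R : Set W) ≤
      Submodule.span S (Set.range fun i => (b i : W)) := by
    rw [Submodule.span_le]
    intro v hv
    rw [show v = _ from hmem ⟨v, hv⟩]
    exact sum_mem fun i _ => Submodule.smul_mem _ _ (Submodule.subset_span ⟨i, rfl⟩)
  let F := (Module.Basis.span hb).constr S fun i => (g (b i) : W)
  refine ⟨F ∘ₗ Submodule.inclusion hspan, fun v => ?_⟩
  have hv : Submodule.inclusion hspan ⟨v, Submodule.subset_span v.2⟩ =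
      ∑ i, algebraMap R S (b.repr v i) • Module.Basis.span hb i := by
    apply Subtype.ext
    simp only [AddSubmonoidClass.coe_finsetSum, Submodule.coe_smul, Module.Basis.span_apply]
    exact hmem v
  rw [LinearMap.comp_apply, hv, map_sum]
  simp only [map_smul, F, Module.Basis.constr_basis]
  conv_rhs => rw [← b.sum_repr v]
  simp only [AddSubmonoidClass.coe_finsetSum, Submodule.coe_smul, map_sum, map_smul,
    algebraMap_smul]

/-- An endomorphism of the invariants that preserves the order of vanishing extends to `W`. -/
theorem exists_extension {p : S} (hp : Irreducible p) {M : ℕ}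
    (h : ∀ w : W, w ∈ AddSubmonoid.closure {u : W | ∃ c ≤ M, p ^ c • u ∈ D.invariants R})
    (g : D.invariants R →ₗ[R] D.invariants R)
    (hg : ∀ c, ∀ v ∈ D.sections R c, g v ∈ D.sections R c) :
    ∃ θ : W →ₗ[S] W, ∀ v : D.invariants R, θ v = g v := by
  have hpM : p ^ M ≠ 0 := pow_ne_zero _ hp.ne_zero
  obtain ⟨G, hG⟩ := exists_extension_span ⟨hpM, D.smul_mem_span_invariants h⟩ g
  let m : W →ₗ[S] W := p ^ M • LinearMap.id
  have hm : Function.Injective m := smul_right_injective W hpM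
  -- `F` is `p ^ M` times the desired `θ`; it remains to see that its values are divisible by `p ^
  -- M`.
  let F : W →ₗ[S] W := G ∘ₗ m.codRestrict _ (D.smul_mem_span_invariants h)
  have hF : ∀ w, F w ∈ LinearMap.range m := by
    intro w
    induction h w using AddSubmonoid.closure_induction with
    | mem u hu =>
      obtain ⟨c, hc, hu⟩ := hu
      obtain ⟨d, rfl⟩ := Nat.exists_eq_add_of_le' hc
      -- Here preservation of the order of vanishing enters: `g (p ^ c • u)` is again divisible by
      -- `p ^ c`, and the remaining factor `p ^ d` comes from linearity.
      obtain ⟨u', hu'⟩ := (mem_sections D hp).1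
        (hg c ⟨p ^ c • u, hu⟩ ((mem_sections D hp).2 ⟨u, rfl⟩))
      refine ⟨u', ?_⟩
      have h1 : m.codRestrict _ (D.smul_mem_span_invariants h) u =
          p ^ d • ⟨p ^ c • u, Submodule.subset_span hu⟩ :=
        Subtype.ext (by
          change p ^ (d + c) • u = p ^ d • p ^ c • u
          rw [pow_add, mul_smul])
      change p ^ (d + c) • u' = G _
      rw [h1, map_smul, hG ⟨_, hu⟩, ← hu', pow_add, mul_smul]
    | zero => rw [map_zero]; exact zero_mem _
    | add a b _ _ ha hb => rw [map_add]; exact add_mem ha hb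
  let e := LinearEquiv.ofInjective m hm
  refine ⟨e.symm.toLinearMap ∘ₗ F.codRestrict _ hF, fun v => ?_⟩
  rw [LinearMap.comp_apply, LinearEquiv.coe_coe, LinearEquiv.symm_apply_eq]
  apply Subtype.ext
  change G _ = p ^ M • (g v : W)
  rw [← hG, ← map_smul]
  rfl

end Extension

end GammaOrthogonal


namespace GammaOrthogonal

variable {Γ R S W : Type*} [Group Γ] [Finite Γ] [CommRing R] [IsDomain R]
  [IsDiscreteValuationRing R] [CommRing S] [IsDomain S] [IsDiscreteValuationRing S]
  [Algebra ℂ R] [Algebra R S] [FaithfulSMul R S]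
  [MulSemiringAction Γ S] [IsGaloisGroup Γ R S] [AddCommGroup W] [Module S W] [Module.Free S W]
  [Module.Finite S W] [Module R W]
  [IsScalarTower R S W] [DistribMulAction Γ W] {D : GammaOrthogonal Γ S W}

/-! ### Restriction of equivariant isometries to the invariants. -/

section Restriction

variable (R) in
/-- The restriction to the invariants of an equivariant endomorphism. -/
def restrictInvariants (f : W →ₗ[S] W) (hf : ∀ (γ : Γ) w, f (γ • w) = γ • f w) :
    D.invariants R →ₗ[R] D.invariants R :=
  (f.restrictScalars R).restrict fun v hv γ => by
    rw [LinearMap.restrictScalars_apply, ← hf, hv]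

variable (R) in
/-- The restriction to the invariants of an equivariant automorphism. -/
def restrictAut (θ : D.autGroup) : D.invariants R ≃ₗ[R] D.invariants R :=
  LinearEquiv.ofLinearMap (restrictInvariants R ((θ : W ≃ₗ[S] W) : W →ₗ[S] W) θ.2.2)
    (restrictInvariants R ((θ⁻¹ : D.autGroup) : W ≃ₗ[S] W).toLinearMap (θ⁻¹).2.2)
    (LinearMap.ext fun v => Subtype.ext ((θ : W ≃ₗ[S] W).apply_symm_apply v))
    (LinearMap.ext fun v => Subtype.ext ((θ : W ≃ₗ[S] W).symm_apply_apply v))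

@[simp] theorem coe_restrictAut (θ : D.autGroup) (v : D.invariants R) :
    (restrictAut R θ v : W) = (θ : W ≃ₗ[S] W) v := rfl

theorem restrictAut_mem_sections (θ : D.autGroup) {c : ℕ} {v : D.invariants R}
    (hv : v ∈ D.sections R c) : restrictAut R θ v ∈ D.sections R c := by
  obtain ⟨t, ht⟩ := IsDiscreteValuationRing.exists_irreducible S
  obtain ⟨w, hw⟩ := (mem_sections D ht).1 hv
  exact (mem_sections D ht).2 ⟨(θ : W ≃ₗ[S] W) w, by rw [coe_restrictAut, ← hw, map_smul]⟩

theorem map_fullFlag_le {g : D.invariants R ≃ₗ[R] D.invariants R} {c : ℕ}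
    (hg : ∀ v ∈ D.sections R c, g v ∈ D.sections R c) :
    (D.fullFlag R c).map (fibreMap (g : D.invariants R →ₗ[R] D.invariants R)) ≤
      D.fullFlag R c := by
  rintro _ ⟨_, ⟨v, hv, rfl⟩, rfl⟩
  exact ⟨g v, hg v hv, rfl⟩

theorem map_flag_le {g : D.invariants R ≃ₗ[R] D.invariants R}
    (hg : ∀ c, ∀ v ∈ D.sections R c, g v ∈ D.sections R c) (i : ℕ) :
    (D.flag R i).map (fibreMap (g : D.invariants R →ₗ[R] D.invariants R)) ≤ D.flag R i := by
  cases i with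
  | zero => exact le_top
  | succ i =>
    rw [flag]
    split_ifs
    · exact map_fullFlag_le (hg _)
    · rw [Submodule.map_bot]

variable [Module.Finite R S]

theorem preservesFlag_of_sections {g : D.invariants R ≃ₗ[R] D.invariants R}
    (hg : ∀ c, ∀ v ∈ D.sections R c, g v ∈ D.sections R c)
    (hg' : ∀ c, ∀ v ∈ D.sections R c, g⁻¹ v ∈ D.sections R c) :
    (D.degenerate R).PreservesFlag g := fun i => by
  refine le_antisymm (map_flag_le hg i) fun x hx => ?_
  refine ⟨fibreMap ((g⁻¹ : D.invariants R ≃ₗ[R] D.invariants R) :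
    D.invariants R →ₗ[R] D.invariants R) x, map_flag_le hg' i ⟨x, hx, rfl⟩, ?_⟩
  rw [← fibreMap_mul, mul_inv_cancel]
  exact fibreMap_id x

theorem isAut_restrictAut (θ : D.autGroup) : (D.degenerate R).IsAut (restrictAut R θ) := by
  refine DegenerateOrthogonal.isAut_of_form_of_flag (fun v w => ?_)
    (preservesFlag_of_sections (fun _ _ => restrictAut_mem_sections θ)
      fun _ _ => restrictAut_mem_sections θ⁻¹)
  change D.baseForm R _ _ = D.baseForm R _ _
  apply FaithfulSMul.algebraMap_injective R S
  rw [algebraMap_baseForm, algebraMap_baseForm]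
  exact θ.2.1 _ _

end Restriction

/-! ### Lifting automorphisms of the flagged bundle to `W`. -/

section Lifting

/-- No `F_y ^ c` is lost in the reduced flag: for `c ≥ 1` the subspace is constant from `c` up to
the first jump at or after `c`, and it is zero if there is no such jump. -/
theorem exists_flag_eq_fullFlag {s : R} {t δ : S} {e : ℕ} (H : Ramified R s t δ e) (c : ℕ) :
    ∃ i, D.flag R i = D.fullFlag R c := by
  classical
  rcases Nat.eq_zero_or_pos c with rfl | hc
  · refine ⟨0, (eq_top_iff.2 fun x _ => ?_).symm⟩
    obtain ⟨v, rfl⟩ := toFibre_surjective x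
    exact ⟨v, mem_sections_zero v, rfl⟩
  by_cases h : ∃ k, ∃ hk : k < D.flagLength R, c ≤ D.jump R ⟨k, hk⟩
  · obtain ⟨hk, hkc⟩ := Nat.find_spec h
    refine ⟨Nat.find h + 1, flag_succ_eq H hc hk.le (fun j hj => ?_) fun j hj => ?_⟩
    · by_contra! hcon
      exact Nat.find_min h hj ⟨j.2, hcon⟩
    · exact hkc.trans ((D.jump R).monotone (Fin.le_def.2 hj))
  · push Not at h
    exact ⟨D.flagLength R + 1, flag_succ_eq H hc le_rfl (fun j _ => h j j.2)
      fun j hj => absurd j.2 (by omega)⟩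

variable [Module.Finite R S]

/-- For `c ≤ e`, `V ∩ m_y ^ c W` contains `m_x V`, so it is the full preimage of `F_y ^ c`, a step
of the flag. For `c > e` it is `s` times `V ∩ m_y ^ (c - e) W`, and induction applies since `e ≥ 1`.
-/
theorem mem_sections_of_preservesFlag {g : D.invariants R ≃ₗ[R] D.invariants R}
    (hg : (D.degenerate R).PreservesFlag g) (c : ℕ) (v : D.invariants R)
    (hv : v ∈ D.sections R c) : g v ∈ D.sections R c := by
  obtain ⟨s, t, δ, e, H⟩ := exists_ramified R (Γ := Γ) (S := S) ‹_›
  induction c using Nat.strong_induction_on generalizing v with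
  | _ c ih =>
    by_cases hc : c ≤ e
    · obtain ⟨i, hi⟩ := exists_flag_eq_fullFlag (D := D) H c
      have hi' : (D.degenerate R).flag i = D.fullFlag R c := hi
      rw [← mem_fullFlag H hc, ← hi'] at hv ⊢
      exact hg.mem i hv
    · obtain ⟨d, rfl⟩ := Nat.exists_eq_add_of_le' (not_le.1 hc).le
      have he := H.pos
      obtain ⟨v', rfl⟩ := (mem_smul_top H).1
        ((mem_sections_e H).1 (D.sections_antitone R (Nat.le_add_left e d) hv))
      have hv' : v' ∈ D.sections R d := by
        obtain ⟨w, hw⟩ := (mem_sections D H.irr').1 hv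
        obtain ⟨ε, hε⟩ := H.unit.exists_right_inv
        refine (mem_sections D H.irr').2 ⟨ε • w, ?_⟩
        -- As `s = t ^ e * δ`, cancelling `t ^ e` and inverting `δ` (by `ε`) shows that division by
        -- `s` lowers the order by exactly `e`.
        apply smul_right_injective W (pow_ne_zero e H.irr'.ne_zero)
        have h1 : t ^ (d + e) • w = (t ^ e * δ) • (v' : W) := by
          rw [hw, ← H.eq, algebraMap_smul]; rfl
        change t ^ e • t ^ d • ε • w = t ^ e • (v' : W)
        rw [smul_smul, smul_smul, show t ^ e * t ^ d * ε = ε * t ^ (d + e) by ring, mul_smul, h1,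
          smul_smul, show ε * (t ^ e * δ) = t ^ e * (δ * ε) by ring, hε, mul_one]
      obtain ⟨w, hw⟩ := (mem_sections D H.irr').1 (ih d (by omega) v' hv')
      refine (mem_sections D H.irr').2 ⟨δ • w, ?_⟩
      rw [map_smul, Submodule.coe_smul, ← hw, ← algebraMap_smul S s, H.eq, smul_smul, smul_smul]
      congr 1
      ring

/-- Agreement on `V` propagates to `W` one variable at a time, the second time for maps from `W` to
its dual. -/
theorem form_extension {a : S} (ha : IsDenominator R D a) {θ : W →ₗ[S] W}
    {g : D.invariants R ≃ₗ[R] D.invariants R}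
    (hg : ∀ v w, D.baseForm R (g v) (g w) = D.baseForm R v w)
    (hθ : ∀ v : D.invariants R, θ v = g v) (v w : W) : D.form (θ v) (θ w) = D.form v w := by
  have h1 : ∀ v : D.invariants R, (D.form (θ v)) ∘ₗ θ = D.form v := fun v => ha.ext fun w => by
    rw [LinearMap.comp_apply, hθ, hθ, ← algebraMap_baseForm, hg, algebraMap_baseForm]
  have h2 : (D.form.compl₁₂ θ θ) = D.form := ha.ext h1
  exact LinearMap.congr_fun₂ h2 v w

/-- Both sides are only semilinear in `w`, so `IsDenominator.ext` does not apply. The identity is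
proved on the span of `V`, then for `a • w`, and the non-zero scalar `γ • a` is cancelled. -/
theorem smul_extension {a : S} (ha : IsDenominator R D a) {θ : W →ₗ[S] W}
    {g : D.invariants R →ₗ[R] D.invariants R}
    (hθ : ∀ v : D.invariants R, θ v = g v) (γ : Γ) (w : W) : θ (γ • w) = γ • θ w := by
  have h : ∀ w ∈ Submodule.span S (D.invariants R : Set W), θ (γ • w) = γ • θ w := fun w hw => by
    induction hw using Submodule.span_induction with
    | mem v hv => rw [hv γ, hθ ⟨v, hv⟩, (g ⟨v, hv⟩).2 γ]
    | zero => simp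
    | add x y _ _ hx hy => rw [smul_add, map_add, map_add, smul_add, hx, hy]
    | smul b x _ hx => rw [D.semilinear, θ.map_smul, θ.map_smul, D.semilinear, hx]
  have h1 := h _ (ha.2 w)
  rw [D.semilinear, θ.map_smul, θ.map_smul, D.semilinear] at h1
  refine smul_right_injective W (fun h0 => ha.1 ?_) h1
  rwa [smul_eq_zero_iff_eq] at h0

/-- Every automorphism of the degenerate orthogonal bundle with flags extends to `W`. -/
theorem exists_restrictAut_eq {p : S} (hp : Irreducible p) {M : ℕ}
    (h : ∀ w : W, w ∈ AddSubmonoid.closure {u : W | ∃ c ≤ M, p ^ c • u ∈ D.invariants R})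
    (g : (D.degenerate R).autGroup) :
    ∃ θ : D.autGroup, restrictAut R θ = g := by
  have ha : IsDenominator R D (p ^ M) :=
    ⟨pow_ne_zero _ hp.ne_zero, D.smul_mem_span_invariants h⟩
  obtain ⟨θ, hθ⟩ := exists_extension hp h (g : D.invariants R ≃ₗ[R] D.invariants R).toLinearMap
    (mem_sections_of_preservesFlag g.2.flag)
  -- The inverse is extended too; both composites are the identity on `V`, hence on `W`.
  obtain ⟨η, hη⟩ := exists_extension hp h
    ((g⁻¹ : (D.degenerate R).autGroup) : D.invariants R ≃ₗ[R] D.invariants R).toLinearMap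
    (mem_sections_of_preservesFlag (g⁻¹).2.flag)
  refine ⟨⟨LinearEquiv.ofLinearMap θ η (ha.ext fun v => ?_) (ha.ext fun v => ?_),
    form_extension ha g.2.form hθ, smul_extension ha hθ⟩, ?_⟩
  · rw [LinearMap.comp_apply, hη, hθ]
    exact congrArg Subtype.val
      ((g : D.invariants R ≃ₗ[R] D.invariants R).apply_symm_apply v)
  · rw [LinearMap.comp_apply, hθ, hη]
    exact congrArg Subtype.val
      ((g : D.invariants R ≃ₗ[R] D.invariants R).symm_apply_apply v)
  · exact LinearEquiv.ext fun v => Subtype.ext (hθ v)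

variable (R D) in
/-- Restriction to the invariants, as a homomorphism of automorphism groups. -/
def restrictHom : D.autGroup →* (D.degenerate R).autGroup where
  toFun θ := ⟨restrictAut R θ, isAut_restrictAut θ⟩
  map_one' := rfl
  map_mul' _ _ := rfl

theorem restrictHom_injective {a : S} (ha : IsDenominator R D a) :
    Function.Injective (D.restrictHom R) := fun θ η h => by
  have h1 : ((θ : W ≃ₗ[S] W) : W →ₗ[S] W) = ((η : W ≃ₗ[S] W) : W →ₗ[S] W) :=
    ha.ext fun v => congrArg Subtype.val (LinearEquiv.congr_fun (congrArg Subtype.val h) v)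
  exact Subtype.ext (LinearEquiv.toLinearMap_injective h1)

end Lifting

end GammaOrthogonal

end

end OrthogonalGerm

/-! ### The proposition. -/

theorem mainTheorem10 {Γ R S W : Type*} [Group Γ] [Finite Γ]
    [CommRing R] [IsDomain R] [IsDiscreteValuationRing R]
    [CommRing S] [IsDomain S] [IsDiscreteValuationRing S]
    [Algebra ℂ R] [Algebra ℂ S] [Algebra R S] [IsScalarTower ℂ R S]
    [Module.Finite R S] [FaithfulSMul R S]
    (hS : Function.Bijective (algebraMap ℂ (IsLocalRing.ResidueField S)))
    [MulSemiringAction Γ S] [IsGaloisGroup Γ R S]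
    [AddCommGroup W] [Module S W] [Module.Free S W] [Module.Finite S W]
    [Module R W] [IsScalarTower R S W] [DistribMulAction Γ W]
    (D : OrthogonalGerm.GammaOrthogonal Γ S W) :
    Module.finrank R (D.invariants R) = Module.finrank S W ∧
    (∀ i j hi hj hij, Function.Bijective ((D.degenerate R).pairing i j hi hj hij)) ∧
    Function.Bijective (D.degenerate R).zeroForm ∧
    ∃ Φ : D.autGroup ≃* (D.degenerate R).autGroup,
      ∀ (θ : D.autGroup) (v : D.invariants R),
        (((Φ θ : D.invariants R ≃ₗ[R] D.invariants R) v : D.invariants R) : W) =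
          (θ : W ≃ₗ[S] W) (v : W) := by
  obtain ⟨p, χ, hp, hχ, hpχ⟩ :=
    OrthogonalGerm.GammaOrthogonal.exists_eigen_uniformizer (Γ := Γ) (R := R) hS
  obtain ⟨M, hM⟩ := D.exists_sum_eigenvectors (R := R) hχ hpχ
  have ha : D.IsDenominator R (p ^ M) :=
    ⟨pow_ne_zero _ hp.ne_zero, D.smul_mem_span_invariants hM⟩
  refine ⟨D.finrank_invariants R ha,
    fun _ _ hi hj hij => (D.degenerate R).pairing_bijective hi hj hij,
    (D.degenerate R).zeroForm_bijective,
    MulEquiv.ofBijective (D.restrictHom R) ⟨D.restrictHom_injective ha, fun g => ?_⟩,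
    fun θ v => rfl⟩
  obtain ⟨θ, hθ⟩ := OrthogonalGerm.GammaOrthogonal.exists_restrictAut_eq hp hM g
  exact ⟨θ, Subtype.ext hθ⟩
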